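/- **Setting.** Units $i=0,1,2,\dots$ carry covariates $X_i\in\mathbb R^d$, a treatment $W_i\in\{0,1\}$, potential outcomes $Y_i(0),Y_i(1)\in\mathbb R$ and a study membership $H_i\in\{1,\dots,K\}$; the tuples are i.i.d. and one observes $(X_i,W_i,Y_i,H_i)_{i<n}$ with $Y_i=Y_i(W_i)$. Put $\rho_k=\mathbb P(H=k)>0$, $p_k=\mathbb P(W=1\mid H=k)\in(0,1)$, $\Sigma_k=\mathbb V(X\mid H=k)$. Within each study $W$ is independent of $(X,Y(0),Y(1))$; the law of $X$ given $H=k$ and $p_k$ may depend on $k$. $X$ has finite second moments, every $\Sigma_k$ is positive definite, and $$Y(w)=c^{(w)}+X\beta^{(w)}+\varepsilon(w),\qquad \mathbb E(\varepsilon(w)\mid X,H)=0,\qquad \mathbb V(\varepsilon(w)\mid X,H)=\sigma^2>0,\qquad w\in\{0,1\}.$$ Let $\tau=\mathbb E(Y(1)-Y(0))$, $\tau_k=\mathbb E(Y(1)-Y(0)\mid H=k)$, $X'=(1,X)$, $\theta^{(w)}=(c^{(w)},\beta^{(w)})$, and let $n_k$, $n^{(w)}$, $n_k^{(w)}$ be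 the numbers of units $i<n$ in study $k$, in arm $w$, and in arm $w$ of study $k$. *Local full rank* is the event that, for all $k,w$, the design matrix with intercept $X_k'^{(w)}$ of arm $w$ in study $k$ has rank $d+1$. **Estimators.** Given coefficients $\hat\theta^{(0)},\hat\theta^{(1)}$, the G-formula over a set of units is the average of $X_i'\hat\theta^{(1)}-X_i'\hat\theta^{(0)}$ over it. * $\hat\tau_{\rm pool}$: G-formula over all $n$ units with the least squares coefficients $\hat\theta^{(w)}_{\rm pool}$ of arm $w$ of the pooled data. * $\hat\tau_{\text{Meta-SW}}=\sum_k\frac{n_k}{n}\hat\tau_k$, with $\hat\tau_k$ the G-formula over study $k$ with the local least squares coefficients $\hat\theta_k^{(w)}$. * $\hat\tau_{\text{1S-IVW}}=\sum_k\frac{n_k}n\hat\tau_k^{\text{1S-IVW}}$, with $\hat\tau_k^{\text{1S-IVW}}$ the G-formula over study $k$ with $\hat\theta^{(w)}=\big(\sum_k V_{k,w}^{-1}\big)^{-1}\sum_kV_{k,w}^{-1}\hat\theta_k^{(w)}$, $V_{k,w}=\sigma^2(X_k'^{(w)\top}X_k'^{(w)})^{-1}$. * $\hat\tau_{\rm GD}=\sum_k\frac{n_k}n\hat\tau_k^{\rm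 GD}$, with $\hat\tau_k^{\rm GD}$ the G-formula over study $k$ with the limit, as the number of communication rounds tends to infinity, of FedAvg for the mean squared error of arm $w$ (one full-batch local gradient step per round, averaging weights $n_k^{(w)}/n^{(w)}$, any fixed initial point, any measurable, possibly data-dependent learning rate $0<\eta<2/L$, $L$ the largest eigenvalue of the Hessian of the pooled mean squared error). For an estimator $\hat\tau$ write $\mathbb V^\infty(\hat\tau)=v$ if $\sqrt n(\hat\tau-\tau)\to\mathcal N(0,v)$ in distribution, and $\mathbb V^\infty_H(\hat\tau)=v$ if $\sqrt n\big(\hat\tau-\sum_k\frac{n_k}n\tau_k\big)\to\mathcal N(0,v)$ in distribution (the variability due to the study memberships being removed). Let $$v_{\rm Meta}=\sigma^2\sum_{k}\frac{\rho_k}{p_k(1-p_k)}+(\beta^{(1)}-\beta^{(0)})^\top\Big(\sum_{k}\rho_k\Sigma_k\Big)(\beta^{(1)}-\beta^{(0)}).$$ **Theorem.** 1. All the following asymptotic variances exist, and $$\mathbb V^\infty(\hat\tau_{\rm pool})=\mathbb V^\infty(\hat\tau_{\rm GD})=\mathbb V^\infty(\hat\tau_{\text{1S-IVW}})\le\mathbb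 V^\infty(\hat\tau_{\text{Meta-SW}})=v_{\rm Meta}+\sum_k\rho_k(\tau_k-\tau)^2 .$$ 2. Likewise $$\mathbb V_H^\infty(\hat\tau_{\rm pool})=\mathbb V_H^\infty(\hat\tau_{\rm GD})=\mathbb V_H^\infty(\hat\tau_{\text{1S-IVW}})\le\mathbb V_H^\infty(\hat\tau_{\text{Meta-SW}})=v_{\rm Meta}.$$ 3. $\hat\tau_{\text{Meta-SW}}$ is unbiased under local full rank, in the following sense. * If an event $S$ depends only on $(H_i,W_i)_{i<n}$, local full rank holds almost surely on $S$, and $\hat\tau_{\text{Meta-SW}}$ is integrable on $S$, then $\mathbb E(\hat\tau_{\text{Meta-SW}}\mathbf 1_S)=\mathbb E\big(\sum_k\frac{n_k}n\tau_k\mathbf 1_S\big)$; and $\mathbb E\big(\sum_k\frac{n_k}n\tau_k\big)=\tau$ for $n\ge1$. * If $S$ depends only on $(H_i,W_i,X_i)_{i<n}$, with the same two provisos, then $\mathbb E(\hat\tau_{\text{Meta-SW}}\mathbf 1_S)=\mathbb E\big(\frac1n\sum_{i<n}X_i'(\theta^{(1)}-\theta^{(0)})\mathbf 1_S\big)$;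 and $\mathbb E\big(\frac1n\sum_{i<n}X_i'(\theta^{(1)}-\theta^{(0)})\big)=\tau$ for $n\ge1$. * If $\hat\tau_{\text{Meta-SW}}$ is integrable on the event of local full rank for all large $n$, then $\mathbb E(\hat\tau_{\text{Meta-SW}}\mid\text{local full rank})\to\tau$ as $n\to\infty$. -/

import Mathlib

open MeasureTheory ProbabilityTheory Filter Topology Finset Matrix

noncomputable section

namespace FedRCT

/-- An infinite sequence of units observed in `K` studies: covariates `X i`, treatment `W i`
(`true` = treated), potential outcomes `Y w i` and study membership `H i`. The sample of size `n`
consists of the units `i < n`. -/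
structure Units (Ω : Type*) (d K : ℕ) where
  X : ℕ → Ω → Fin d → ℝ
  W : ℕ → Ω → Bool
  Y : Bool → ℕ → Ω → ℝ
  H : ℕ → Ω → Fin K

variable {Ω : Type*} {d K : ℕ}

/-- The vector `(1, x)`. -/
def aug (x : Fin d → ℝ) : Fin (d + 1) → ℝ := Fin.cons 1 x

namespace Units

variable (D : Units Ω d K)

/-- Observed outcome, `Y = W Y(1) + (1 - W) Y(0)`. -/
def Yobs (i : ℕ) (ω : Ω) : ℝ := D.Y (D.W i ω) i ω

/-- Noise `ε(w) = Y(w) - c(w) - X β(w)`. -/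
def noise (c : Bool → ℝ) (β : Bool → Fin d → ℝ) (w : Bool) (i : ℕ) (ω : Ω) : ℝ :=
  D.Y w i ω - c w - D.X i ω ⬝ᵥ β w

/-! ### Subsamples -/

/-- Indices of the units of study `k`. -/
def studyIdx (n : ℕ) (k : Fin K) (ω : Ω) : Finset ℕ := {i ∈ range n | D.H i ω = k}

/-- Indices of the units of arm `w`. -/
def armIdx (n : ℕ) (w : Bool) (ω : Ω) : Finset ℕ := {i ∈ range n | D.W i ω = w}

/-- Indices of the units of arm `w` in study `k`. -/
def cellIdx (n : ℕ) (k : Fin K) (w : Bool) (ω : Ω) : Finset ℕ :=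
  {i ∈ range n | D.H i ω = k ∧ D.W i ω = w}

/-- The proportion `n_k / n`. -/
def studyFrac (n : ℕ) (k : Fin K) (ω : Ω) : ℝ := ((D.studyIdx n k ω).card : ℝ) / n

/-! ### Least squares -/

/-- `X'ᵀ X'` over the subsample `s`. -/
def gram (s : Finset ℕ) (ω : Ω) : Matrix (Fin (d + 1)) (Fin (d + 1)) ℝ :=
  ∑ i ∈ s, vecMulVec (aug (D.X i ω)) (aug (D.X i ω))

/-- Least squares coefficients `(X'ᵀ X')⁻¹ X'ᵀ Y` over the subsample `s`. -/
def ols (s : Finset ℕ) (ω : Ω) : Fin (d + 1) → ℝ :=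
  (D.gram s ω)⁻¹ *ᵥ ∑ i ∈ s, D.Yobs i ω • aug (D.X i ω)

/-- Every design matrix (with intercept) of one arm in one study has full column rank. -/
def LocalFullRank (n : ℕ) (ω : Ω) : Prop :=
  ∀ (k : Fin K) (w : Bool), (D.gram (D.cellIdx n k w ω) ω).rank = d + 1

/-- Plug-in G-formula: average over `s` of `X'ᵢ θ(1) - X'ᵢ θ(0)`. -/
def gFormula (s : Finset ℕ) (θ : Bool → Fin (d + 1) → ℝ) (ω : Ω) : ℝ :=
  (∑ i ∈ s, (aug (D.X i ω) ⬝ᵥ θ true - aug (D.X i ω) ⬝ᵥ θ false)) / (s.card : ℝ)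

/-- Study-wise G-formulas with common parameters `θ`, aggregated with weights `n_k / n`. -/
def federated (n : ℕ) (θ : Bool → Fin (d + 1) → ℝ) (ω : Ω) : ℝ :=
  ∑ k, D.studyFrac n k ω * D.gFormula (D.studyIdx n k ω) θ ω

/-! ### Pooled estimator -/

def tauPool (n : ℕ) (ω : Ω) : ℝ :=
  D.gFormula (range n) (fun w => D.ols (D.armIdx n w ω) ω) ω

/-! ### Meta-analysis with sample-size weights -/

/-- The local estimator in study `k`. -/
def tauLocal (n : ℕ) (k : Fin K) (ω : Ω) : ℝ :=
  D.gFormula (D.studyIdx n k ω) (fun w => D.ols (D.cellIdx n k w ω) ω) ω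

def tauMetaSW (n : ℕ) (ω : Ω) : ℝ := ∑ k, D.studyFrac n k ω * D.tauLocal n k ω

/-! ### One-shot federation with inverse variance weights -/

/-- Variance matrix of the local least squares coefficients given the design,
`σ² (X'ᵀ X')⁻¹`. -/
def localVar (σ : ℝ) (n : ℕ) (k : Fin K) (w : Bool) (ω : Ω) :
    Matrix (Fin (d + 1)) (Fin (d + 1)) ℝ :=
  σ ^ 2 • (D.gram (D.cellIdx n k w ω) ω)⁻¹

/-- Inverse variance weighted average of the local coefficients. -/
def thetaIVW (σ : ℝ) (n : ℕ) (ω : Ω) (w : Bool) : Fin (d + 1) → ℝ :=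
  (∑ k, (D.localVar σ n k w ω)⁻¹)⁻¹ *ᵥ
    ∑ k, (D.localVar σ n k w ω)⁻¹ *ᵥ D.ols (D.cellIdx n k w ω) ω

def tauIVW (σ : ℝ) (n : ℕ) (ω : Ω) : ℝ := D.federated n (D.thetaIVW σ n ω) ω

/-! ### Federated gradient descent (FedAvg) -/

/-- Gradient of the mean squared error over the (full) batch `s`. -/
def lossGrad (s : Finset ℕ) (ω : Ω) (θ : Fin (d + 1) → ℝ) : Fin (d + 1) → ℝ :=
  -(2 / (s.card : ℝ)) • ∑ i ∈ s, (D.Yobs i ω - aug (D.X i ω) ⬝ᵥ θ) • aug (D.X i ω)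

/-- `E` local full-batch gradient steps with learning rate `η`. -/
def localUpdate (s : Finset ℕ) (ω : Ω) (η : ℝ) (E : ℕ) (θ : Fin (d + 1) → ℝ) :
    Fin (d + 1) → ℝ :=
  (fun θ' => θ' - η • D.lossGrad s ω θ')^[E] θ

/-- One communication round for arm `w`: local updates, then averaging with weights
`n_k(w) / n(w)`. -/
def fedAvgRound (n : ℕ) (w : Bool) (ω : Ω) (η : ℝ) (E : ℕ) (θ : Fin (d + 1) → ℝ) :
    Fin (d + 1) → ℝ :=
  ∑ k, (((D.cellIdx n k w ω).card : ℝ) / ((D.armIdx n w ω).card : ℝ)) •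
    D.localUpdate (D.cellIdx n k w ω) ω η E θ

/-- FedAvg after `T` rounds, started at `θ₀`. -/
def fedAvg (n : ℕ) (w : Bool) (ω : Ω) (η : ℝ) (E T : ℕ) (θ₀ : Fin (d + 1) → ℝ) :
    Fin (d + 1) → ℝ :=
  (D.fedAvgRound n w ω η E)^[T] θ₀

/-- FedAvg with one local step per round, run to convergence. -/
def thetaGD (η : ℕ → Bool → Ω → ℝ) (θ₀ : Bool → Fin (d + 1) → ℝ) (n : ℕ) (ω : Ω) (w : Bool) :
    Fin (d + 1) → ℝ :=
  limUnder atTop (fun T : ℕ => D.fedAvg n w ω (η n w ω) 1 T (θ₀ w))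

def tauGD (η : ℕ → Bool → Ω → ℝ) (θ₀ : Bool → Fin (d + 1) → ℝ) (n : ℕ) (ω : Ω) : ℝ :=
  D.federated n (D.thetaGD η θ₀ n ω) ω

/-- Hessian of the pooled mean squared error of arm `w`. -/
def lossHess (n : ℕ) (w : Bool) (ω : Ω) : Matrix (Fin (d + 1)) (Fin (d + 1)) ℝ :=
  (2 / ((D.armIdx n w ω).card : ℝ)) • D.gram (D.armIdx n w ω) ω

/-- The learning rates satisfy `0 < η < 2 / L`, where `L` is the smoothness constant (largest
eigenvalue of the Hessian) of the pooled loss; that is, `2 I - η • Hessian` is positive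
definite. They may depend on the data. -/
def IsLearningRate [MeasurableSpace Ω] (η : ℕ → Bool → Ω → ℝ) : Prop :=
  (∀ n w, Measurable (η n w)) ∧ ∀ n w ω, 0 < η n w ω ∧
    ((2 : ℝ) • (1 : Matrix (Fin (d + 1)) (Fin (d + 1)) ℝ) - η n w ω • D.lossHess n w ω).PosDef

/-! ### Population quantities -/

variable [MeasurableSpace Ω] (P : Measure Ω)

/-- The law of the experiment given that a unit belongs to study `k`. -/
def studyMeasure (k : Fin K) : Measure Ω := P[|D.H 0 ⁻¹' {k}]

/-- `ρ_k = P(H = k)`. -/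
def rho (k : Fin K) : ℝ := P.real (D.H 0 ⁻¹' {k})

/-- `p_k = P(W = 1 | H = k)`. -/
def treatProb (k : Fin K) : ℝ := (D.studyMeasure P k).real (D.W 0 ⁻¹' {true})

/-- `Σ_k = V(X | H = k)`. -/
def covStudy (k : Fin K) : Matrix (Fin d) (Fin d) ℝ :=
  Matrix.of fun a b => cov[fun ω => D.X 0 ω a, fun ω => D.X 0 ω b; D.studyMeasure P k]

/-- The average treatment effect `τ = E(Y(1) - Y(0))`. -/
def tau : ℝ := ∫ ω, (D.Y true 0 ω - D.Y false 0 ω) ∂P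

/-- The average treatment effect `τ_k = E(Y(1) - Y(0) | H = k)` in study `k`. -/
def tauStudy (k : Fin K) : ℝ := ∫ ω, (D.Y true 0 ω - D.Y false 0 ω) ∂(D.studyMeasure P k)

/-- `∑_k (n_k / n) τ_k`. -/
def tauGivenH (n : ℕ) (ω : Ω) : ℝ := ∑ k, D.studyFrac n k ω * D.tauStudy P k

/-- `σ² ∑_k ρ_k / (p_k (1 - p_k)) + ‖β(1) - β(0)‖²_Σ` with `Σ = ∑_k ρ_k Σ_k`. -/
def metaVar (β : Bool → Fin d → ℝ) (σ : ℝ) : ℝ :=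
  σ ^ 2 * ∑ k, D.rho P k / (D.treatProb P k * (1 - D.treatProb P k)) +
    (β true - β false) ⬝ᵥ ((∑ k, D.rho P k • D.covStudy P k) *ᵥ (β true - β false))

/-- Between-study variance `∑_k ρ_k (τ_k - τ)²` of the study-level effects. -/
def betweenVar : ℝ := ∑ k, D.rho P k * (D.tauStudy P k - D.tau P) ^ 2

/-- Average over the first `n` units of the effect `X'ᵢ (θ(1) - θ(0))`, `θ(w) = (c(w), β(w))`. -/
def sampleEffect (c : Bool → ℝ) (β : Bool → Fin d → ℝ) (n : ℕ) (ω : Ω) : ℝ :=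
  D.gFormula (range n) (fun w => Fin.cons (c w) (β w)) ω

/-- The σ-algebra of the memberships and treatments of the first `n` units. -/
@[reducible]
def assignmentSigma (n : ℕ) : MeasurableSpace Ω :=
  MeasurableSpace.comap (fun ω (i : Fin n) => (D.H i ω, D.W i ω)) inferInstance

/-- The σ-algebra of the memberships, treatments and covariates of the first `n` units. -/
@[reducible]
def designSigma (n : ℕ) : MeasurableSpace Ω :=
  MeasurableSpace.comap (fun ω (i : Fin n) => (D.H i ω, D.W i ω, D.X i ω)) inferInstance

/-- `K` Bernoulli randomised trials with a common linear outcome model and covariate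
distributions that may differ between the studies (as may the treatment probabilities). -/
structure IsCovariateShiftModel (c : Bool → ℝ) (β : Bool → Fin d → ℝ) (σ : ℝ) : Prop where
  measurable_X : ∀ i, Measurable (D.X i)
  measurable_W : ∀ i, Measurable (D.W i)
  measurable_Y : ∀ w i, Measurable (D.Y w i)
  measurable_H : ∀ i, Measurable (D.H i)
  /-- The units are independent ... -/
  indep : iIndepFun
    (fun i ω => (D.X i ω, D.W i ω, D.Y false i ω, D.Y true i ω, D.H i ω)) P
  /-- ... and identically distributed. -/
  identDistrib : ∀ i, IdentDistrib
    (fun ω => (D.X i ω, D.W i ω, D.Y false i ω, D.Y true i ω, D.H i ω))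
    (fun ω => (D.X 0 ω, D.W 0 ω, D.Y false 0 ω, D.Y true 0 ω, D.H 0 ω)) P P
  rho_pos : ∀ k, 0 < D.rho P k
  treatProb_pos : ∀ k, 0 < D.treatProb P k
  treatProb_lt_one : ∀ k, D.treatProb P k < 1
  /-- Treatment is randomised within each study. -/
  randomized : ∀ k, IndepFun (D.W 0) (fun ω => (D.X 0 ω, D.Y false 0 ω, D.Y true 0 ω))
    (D.studyMeasure P k)
  memLp_X : MemLp (D.X 0) 2 P
  /-- The covariates are not degenerate within any study. -/
  posDef : ∀ k, (D.covStudy P k).PosDef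
  sigma_pos : 0 < σ
  memLp_noise : ∀ w, MemLp (D.noise c β w 0) 2 P
  /-- `E(ε(w) | X, H) = 0`. -/
  noise_mean : ∀ w,
    P[D.noise c β w 0 | MeasurableSpace.comap (fun ω => (D.X 0 ω, D.H 0 ω)) inferInstance]
      =ᵐ[P] fun _ => 0
  /-- `V(ε(w) | X, H) = σ²`. -/
  noise_var : ∀ w,
    P[fun ω => D.noise c β w 0 ω ^ 2 |
        MeasurableSpace.comap (fun ω => (D.X 0 ω, D.H 0 ω)) inferInstance]
      =ᵐ[P] fun _ => σ ^ 2

end Units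

/-- `√n (T n - C n)` converges in distribution to the centred normal law of variance `v`: the
asymptotic variance of the estimator `T` about `C` is `v`. -/
def HasAsympVar [MeasurableSpace Ω] (P : Measure Ω) [IsProbabilityMeasure P]
    (T C : ℕ → Ω → ℝ) (v : ℝ) : Prop :=
  0 ≤ v ∧ TendstoInDistribution (fun (n : ℕ) ω => √(n : ℝ) * (T n ω - C n ω)) atTop
    (id : ℝ → ℝ) (fun _ => P) (gaussianReal 0 v.toNNReal)

end FedRCT

end

/-! Put `Y = X'θ(W) + ε` into the normal equations. Whenever the Gram matrices involved are
invertible, each estimator equals `sampleEffect`, the same for all of them, plus signed terms `n⁻¹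
(∑_B X') ⬝ G_A⁻¹ (∑_A ε X')`. For the pooled estimator `A` is an arm and `B` the whole sample; for
Meta-SW `A` is a cell (arm of a study) and `B` its study (`tauPool_eq`, `tauMetaSW_eq`).

By the strong law the weights of the scores converge to the solution `b` of `bᵀ E(X'X'ᵀ 1_A) = E(X'
1_B)`. The scores are sums of centred i.i.d. terms, so replacing the weights by their limits costs
`o_P(n^{-1/2})`, and the central limit theorem applies to the influence function `(effect - t) + (X'
⬝ b) ε` (`hasAsympVar_of_linear`, `hasAsympVar_of_ols`). Its two parts are uncorrelated and the
noise is homoscedastic, whence the variance `E (effect - t)² + σ² E (X' ⬝ b)²`. The centring `t` is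
`τ` or `τ_k`; the first term is then `ΔβᵀΣΔβ` with or without the between-study variance.

For Meta-SW randomisation makes `b` the constant `±1 / P(W = w | H = k)`, which yields the explicit
variance. Let `v` and `u` be the limiting Meta-SW and pooled weights of a residual. Then `E(uv) =
E(u²)`, so `0 ≤ E(v - u)² = E(v²) - E(u²)`: this is the inequality (`integral_poolWeight_sq_le`).

The other two estimators coincide with the pooled one, almost surely for all large `n`. Inverse
variance weighting adds up the local normal equations. One-step FedAvg is gradient descent on the
pooled loss and converges to its least squares solution.

For unbiasedness, the error of Meta-SW beyond `sampleEffect` is linear in the residuals with weights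
that depend on the design only, hence is centred given the design. Given memberships and treatments,
`sampleEffect` in turn averages to `tauGivenH`. On the event of local full rank, the L¹ law of large
numbers and `P(local full rank) → 1` give the limit `τ`. -/

namespace FedRCT

/-! ### Asymptotic linearity and conditional centring for i.i.d. sequences. -/

section Prob

variable {Ω : Type*} [MeasurableSpace Ω] {P : Measure Ω} [IsProbabilityMeasure P]

lemma tendstoInMeasure_zero_add {f g : ℕ → Ω → ℝ} (hf : TendstoInMeasure P f atTop 0)
    (hg : TendstoInMeasure P g atTop 0) :
    TendstoInMeasure P (fun n ω => f n ω + g n ω) atTop 0 := by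
  rw [tendstoInMeasure_iff_measureReal_norm] at *
  intro ε hε
  have h := (hf (ε / 2) (half_pos hε)).add (hg (ε / 2) (half_pos hε))
  rw [add_zero] at h
  refine squeeze_zero (fun _ => measureReal_nonneg) (fun n => ?_) h
  refine (measureReal_mono ?_).trans (measureReal_union_le _ _)
  intro ω hω
  simp only [Set.mem_ofPred_eq, Pi.zero_apply, sub_zero, Set.mem_union] at hω ⊢
  by_contra! hcon
  linarith [norm_add_le (f n ω) (g n ω)]

lemma tendstoInMeasure_zero_sum {ι : Type*} (s : Finset ι) {f : ι → ℕ → Ω → ℝ}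
    (hf : ∀ a ∈ s, TendstoInMeasure P (f a) atTop 0) :
    TendstoInMeasure P (fun n ω => ∑ a ∈ s, f a n ω) atTop 0 := by
  classical
  induction s using Finset.induction_on with
  | empty =>
    simp only [sum_empty]
    rw [tendstoInMeasure_iff_measureReal_norm]
    intro ε hε
    simp [not_le.2 hε]
  | insert a s ha ih =>
    simp only [sum_insert ha]
    exact tendstoInMeasure_zero_add (hf a (mem_insert_self a s))
      (ih fun b hb => hf b (mem_insert_of_mem hb))

/-- `o_P(1) · O_P(1) = o_P(1)`. -/
lemma tendstoInMeasure_zero_mul {A B : ℕ → Ω → ℝ} (hA : TendstoInMeasure P A atTop 0)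
    (hB : ∀ n, Integrable (B n) P) {C : ℝ} (hC : ∀ n, ∫ ω, |B n ω| ∂P ≤ C) :
    TendstoInMeasure P (fun n ω => A n ω * B n ω) atTop 0 := by
  rw [tendstoInMeasure_iff_measureReal_norm] at *
  intro ε hε
  rw [Metric.tendsto_atTop]
  intro δ hδ
  -- `R` is so large that Markov's inequality gives `P(|B n| ≥ R) < δ/2` for every `n`.
  obtain ⟨R, hR0, hR⟩ : ∃ R : ℝ, 0 < R ∧ C < R * (δ / 2) := by
    refine ⟨max 1 ((C + 1) / (δ / 2)), by positivity, ?_⟩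
    have h1 : C + 1 ≤ max 1 ((C + 1) / (δ / 2)) * (δ / 2) := by
      rw [← div_le_iff₀ (half_pos hδ)]
      exact le_max_right _ _
    linarith
  obtain ⟨N, hN⟩ := (Metric.tendsto_atTop.1 (hA (ε / R) (by positivity))) (δ / 2) (half_pos hδ)
  refine ⟨N, fun n hn => ?_⟩
  have h1 := hN n hn
  rw [Real.dist_0_eq_abs, abs_of_nonneg measureReal_nonneg] at h1 ⊢
  have h2 : P.real {ω | R ≤ |B n ω|} < δ / 2 := by
    have := mul_meas_ge_le_integral_of_nonneg (μ := P) (f := fun ω => |B n ω|)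
      (Eventually.of_forall fun _ => abs_nonneg _) (hB n).abs R
    have h3 := this.trans (hC n)
    exact lt_of_mul_lt_mul_left (h3.trans_lt hR) hR0.le
  have h3 : P.real {ω | ε ≤ ‖A n ω * B n ω - (0 : Ω → ℝ) ω‖} ≤
      P.real {ω | ε / R ≤ ‖A n ω - (0 : Ω → ℝ) ω‖} + P.real {ω | R ≤ |B n ω|} := by
    refine (measureReal_mono ?_).trans (measureReal_union_le _ _)
    intro ω hω
    simp only [Set.mem_ofPred_eq, Pi.zero_apply, sub_zero, Set.mem_union, Real.norm_eq_abs,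
      abs_mul] at hω ⊢
    by_contra! hcon
    have : |A n ω| * |B n ω| < ε / R * R :=
      mul_lt_mul'' hcon.1 hcon.2 (abs_nonneg _) (abs_nonneg _)
    rw [div_mul_cancel₀ _ hR0.ne'] at this
    linarith
  linarith

variable {E : Type*} [MeasurableSpace E] {Z : ℕ → Ω → E}

/-- Independence keeps the second moment of the normalised sum at most `Var ψ`, and `|b| ≤ 1 + b²`.
The bound does not depend on `n`; it is the `O_P(1)` factor in `tendstoInMeasure_zero_mul`. -/
lemma integral_abs_inv_sqrt_mul_sum_le (hind : iIndepFun Z P)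
    (hid : ∀ i, IdentDistrib (Z i) (Z 0) P P) {ψ : E → ℝ} (hψ : Measurable ψ)
    (hψ2 : MemLp (fun ω => ψ (Z 0 ω)) 2 P) (hψ0 : ∫ ω, ψ (Z 0 ω) ∂P = 0) (n : ℕ) :
    Integrable (fun ω => (√(n : ℝ))⁻¹ * ∑ i ∈ range n, ψ (Z i ω)) P ∧
      ∫ ω, |(√(n : ℝ))⁻¹ * ∑ i ∈ range n, ψ (Z i ω)| ∂P ≤
        1 + Var[fun ω => ψ (Z 0 ω); P] := by
  have hidψ : ∀ i, IdentDistrib (fun ω => ψ (Z i ω)) (fun ω => ψ (Z 0 ω)) P P :=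
    fun i => (hid i).comp hψ
  have hL2 : ∀ i, MemLp (fun ω => ψ (Z i ω)) 2 P := fun i => (hidψ i).memLp_iff.2 hψ2
  have hsum : MemLp (∑ i ∈ range n, fun ω => ψ (Z i ω)) 2 P :=
    memLp_finsetSum' _ fun i _ => hL2 i
  have hB2 : MemLp (fun ω => (√(n : ℝ))⁻¹ * ∑ i ∈ range n, ψ (Z i ω)) 2 P := by
    have := hsum.const_mul (√(n : ℝ))⁻¹
    simpa [Finset.sum_apply] using this
  refine ⟨hB2.integrable (by norm_num), ?_⟩
  have hvar : ∫ ω, ((√(n : ℝ))⁻¹ * ∑ i ∈ range n, ψ (Z i ω)) ^ 2 ∂P ≤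
      Var[fun ω => ψ (Z 0 ω); P] := by
    have h1 : Var[∑ i ∈ range n, fun ω => ψ (Z i ω); P] = n * Var[fun ω => ψ (Z 0 ω); P] := by
      rw [IndepFun.variance_sum (fun i _ => hL2 i)]
      · simp [fun i => (hidψ i).variance_eq]
      · intro i _ j _ hij
        exact (hind.indepFun hij).comp hψ hψ
    have h2 : ∫ ω, (∑ i ∈ range n, fun ω => ψ (Z i ω)) ω ∂P = 0 := by
      simp only [Finset.sum_apply]
      rw [integral_finsetSum _ fun i _ => (hL2 i).integrable (by norm_num)]
      exact Finset.sum_eq_zero fun i _ => by rw [(hidψ i).integral_eq, hψ0]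
    rw [variance_of_integral_eq_zero hsum.aestronglyMeasurable.aemeasurable h2] at h1
    simp only [mul_pow]
    rw [integral_const_mul]
    simp only [Finset.sum_apply] at h1
    rw [h1, inv_pow, Real.sq_sqrt (Nat.cast_nonneg n)]
    -- For `n = 0` the left side vanishes because `0⁻¹ = 0`, so only an inequality is claimed.
    rcases Nat.eq_zero_or_pos n with rfl | hn
    · simp [variance_nonneg]
    · have : (n : ℝ) ≠ 0 := by positivity
      rw [inv_mul_cancel_left₀ this]
  calc ∫ ω, |(√(n : ℝ))⁻¹ * ∑ i ∈ range n, ψ (Z i ω)| ∂P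
      ≤ ∫ ω, (1 + ((√(n : ℝ))⁻¹ * ∑ i ∈ range n, ψ (Z i ω)) ^ 2) ∂P := by
        refine integral_mono (hB2.integrable (by norm_num)).abs
          ((integrable_const _).add hB2.integrable_sq) fun ω => ?_
        simp only
        set b := (√(n : ℝ))⁻¹ * ∑ i ∈ range n, ψ (Z i ω)
        rw [← sq_abs b]
        nlinarith [sq_nonneg (|b| - 1), abs_nonneg b]
    _ ≤ _ := by
        rw [integral_add (integrable_const _) hB2.integrable_sq]
        simpa using hvar

/-- An estimator that is asymptotically linear with influence function `φ`, up to products of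
consistent zero sequences and centred averages, has asymptotic variance `V(φ)`. -/
theorem hasAsympVar_of_linear {ι : Type*} [Fintype ι] (hZ : ∀ i, Measurable (Z i))
    (hind : iIndepFun Z P) (hid : ∀ i, IdentDistrib (Z i) (Z 0) P P) {φ : E → ℝ}
    (hφ : Measurable φ) (hφ2 : MemLp (fun ω => φ (Z 0 ω)) 2 P)
    (hφ0 : ∫ ω, φ (Z 0 ω) ∂P = 0) {ψ : ι → E → ℝ} (hψ : ∀ a, Measurable (ψ a))
    (hψ2 : ∀ a, MemLp (fun ω => ψ a (Z 0 ω)) 2 P) (hψ0 : ∀ a, ∫ ω, ψ a (Z 0 ω) ∂P = 0)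
    {A : ℕ → ι → Ω → ℝ} (hA : ∀ n a, Measurable (A n a))
    (hA0 : ∀ a, ∀ᵐ ω ∂P, Tendsto (fun n => A n a ω) atTop (𝓝 0)) {T C : ℕ → Ω → ℝ}
    (hT : ∀ n, Measurable (T n)) (hC : ∀ n, Measurable (C n))
    (h : ∀ᵐ ω ∂P, ∀ᶠ n : ℕ in atTop, T n ω - C n ω = (∑ i ∈ range n, φ (Z i ω)) / n +
      ∑ a, A n a ω * ((∑ i ∈ range n, ψ a (Z i ω)) / n)) :
    HasAsympVar P T C Var[fun ω => φ (Z 0 ω); P] := by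
  refine ⟨variance_nonneg _ _, ?_⟩
  have hclt := tendstoInDistribution_inv_sqrt_mul_sum_sub (P := P)
    (P' := gaussianReal 0 Var[fun ω => φ (Z 0 ω); P].toNNReal)
    (X := fun i ω => φ (Z i ω)) (Y := id) ⟨aemeasurable_id, by simp⟩ hφ2
    (hind.comp (fun _ => φ) fun _ => hφ) (fun i => (hid i).comp hφ)
  simp only [hφ0, mul_zero, sub_zero] at hclt
  have hTC : ∀ n : ℕ, Measurable fun ω => √(n : ℝ) * (T n ω - C n ω) := fun n =>
    ((hT n).sub (hC n)).const_mul _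
  refine tendstoInDistribution_of_tendstoInMeasure_sub _ _ hclt ?_ fun n => (hTC n).aemeasurable
  have hsum : ∀ (f : E → ℝ), Measurable f → ∀ n : ℕ, Measurable fun ω =>
      (√(n : ℝ))⁻¹ * ∑ i ∈ range n, f (Z i ω) := fun f hf n =>
    (Finset.measurable_sum _ fun i _ => hf.comp (hZ i)).const_mul _
  have hrem : TendstoInMeasure P
      (fun (n : ℕ) ω => ∑ a, A n a ω * ((√(n : ℝ))⁻¹ * ∑ i ∈ range n, ψ a (Z i ω))) atTop 0 := by
    refine tendstoInMeasure_zero_sum _ fun a _ => ?_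
    have hB := integral_abs_inv_sqrt_mul_sum_le hind hid (hψ a) (hψ2 a) (hψ0 a)
    refine tendstoInMeasure_zero_mul (A := fun n ω => A n a ω) ?_ (fun n => (hB n).1)
      fun n => (hB n).2
    exact tendstoInMeasure_of_tendsto_ae (fun n => (hA n a).aestronglyMeasurable) (hA0 a)
  -- The expansion `h` holds only eventually, along almost every path; there this difference is
  -- eventually zero, which suffices for convergence in measure.
  have hzero : TendstoInMeasure P
      (fun (n : ℕ) ω => √(n : ℝ) * (T n ω - C n ω) - (√(n : ℝ))⁻¹ * ∑ i ∈ range n, φ (Z i ω) -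
        ∑ a, A n a ω * ((√(n : ℝ))⁻¹ * ∑ i ∈ range n, ψ a (Z i ω))) atTop 0 := by
    refine tendstoInMeasure_of_tendsto_ae (fun n => ?_) ?_
    · exact (((hTC n).sub (hsum φ hφ n)).sub (Finset.measurable_sum _ fun a _ =>
        (hA n a).mul (hsum (ψ a) (hψ a) n))).aestronglyMeasurable
    · filter_upwards [h] with ω hω
      refine tendsto_const_nhds.congr' ?_
      filter_upwards [hω] with n hn
      have hs : ∀ S : ℝ, √(n : ℝ) * (S / n) = (√(n : ℝ))⁻¹ * S := fun S => by
        rw [← Real.sqrt_div_self]; ring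
      simp only [← hs, hn, mul_add, Finset.mul_sum, Pi.zero_apply, add_sub_cancel_left]
      rw [eq_comm, sub_eq_zero]
      exact Finset.sum_congr rfl fun a _ => by ring
  refine (tendstoInMeasure_zero_add hzero hrem).congr_left fun n => ?_
  refine Eventually.of_forall fun ω => ?_
  simp

/-- A function of unit `i` that is centred given a feature of unit `i` is centred given the
features of the first `n` units. -/
lemma setIntegral_eq_zero_of_iIndepFun {F : Type*} [MeasurableSpace F]
    (hZ : ∀ i, Measurable (Z i)) (hind : iIndepFun Z P)
    (hid : ∀ i, IdentDistrib (Z i) (Z 0) P P) {f : E → F} (hf : Measurable f) {r : E → ℝ}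
    (hr : Measurable r) (hrint : Integrable (fun ω => r (Z 0 ω)) P)
    (h0 : ∀ B, MeasurableSet B → ∫ ω in (fun ω => f (Z 0 ω)) ⁻¹' B, r (Z 0 ω) ∂P = 0)
    {n : ℕ} {S : Set Ω}
    (hS : MeasurableSet[MeasurableSpace.comap (fun ω (j : Fin n) => f (Z j ω)) inferInstance] S)
    (i : Fin n) : ∫ ω in S, r (Z i ω) ∂P = 0 := by
  obtain ⟨B, hB, rfl⟩ := hS
  let s : Finset ℕ := {(i : ℕ)}
  let t : Finset ℕ := (range n).erase i
  have hst : Disjoint s t := by simp [s, t]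
  have hI := hind.indepFun_finset s t hst hZ
  let U : Ω → (t → E) := fun ω j => Z j ω
  have hU : Measurable U := measurable_pi_lambda _ fun j => hZ j
  have hI' : IndepFun (Z i) U P :=
    hI.comp (φ := fun x : s → E => x ⟨i, mem_singleton_self _⟩) (ψ := id)
      (measurable_pi_apply _) measurable_id
  -- `g` rebuilds all `n` features from unit `i` and the remaining units, so that the event becomes
  -- a set in a product space on which the law is a product measure.
  let g : E × (t → E) → (Fin n → F) := fun p j =>
    if h : j = i then f p.1 else f (p.2 ⟨j, by
      simp only [t, mem_erase, mem_range]; exact ⟨fun e => h (Fin.ext e), j.2⟩⟩)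
  have hg : Measurable g := by
    refine measurable_pi_lambda _ fun j => ?_
    by_cases h : j = i
    · simp only [g, h, dite_true]; fun_prop
    · simp only [g, h, dite_false]
      exact hf.comp ((measurable_pi_apply _).comp measurable_snd)
  have hgZ : ∀ ω, g (Z i ω, U ω) = fun j : Fin n => f (Z j ω) := by
    intro ω; funext j
    by_cases h : j = i
    · subst h; simp [g]
    · simp [g, h, U]
  have hmeas : MeasurableSet (g ⁻¹' B) := hg hB
  have hpair : Measurable fun ω => (Z i ω, U ω) := (hZ i).prodMk hU
  have hlaw := (indepFun_iff_map_prod_eq_prod_map_map (hZ i).aemeasurable hU.aemeasurable).1 hI'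
  have hset : (fun ω (j : Fin n) => f (Z j ω)) ⁻¹' B = (fun ω => (Z i ω, U ω)) ⁻¹' (g ⁻¹' B) := by
    ext ω; simp [hgZ]
  have hri : Integrable r (P.map (Z i)) := by
    rw [(hid i).map_eq]
    exact (integrable_map_measure hr.aestronglyMeasurable (hZ 0).aemeasurable).2 hrint
  have : IsProbabilityMeasure (P.map U) := Measure.isProbabilityMeasure_map hU.aemeasurable
  have : IsProbabilityMeasure (P.map (Z i)) :=
    Measure.isProbabilityMeasure_map (hZ i).aemeasurable
  have hint : Integrable ((g ⁻¹' B).indicator fun p => r p.1) ((P.map (Z i)).prod (P.map U)) :=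
    (hri.comp_fst _).indicator hmeas
  rw [hset]
  have e1 : ∫ ω in (fun ω => (Z i ω, U ω)) ⁻¹' (g ⁻¹' B), r (Z i ω) ∂P =
      ∫ p in g ⁻¹' B, r p.1 ∂(P.map fun ω => (Z i ω, U ω)) :=
    (setIntegral_map hmeas (hr.comp measurable_fst).aestronglyMeasurable hpair.aemeasurable).symm
  -- Fubini with the other units frozen: each section is an event about the feature of unit `i`
  -- alone, and `h0` makes the inner integral zero.
  rw [e1, hlaw, ← integral_indicator hmeas, integral_prod_symm _ hint]
  refine integral_eq_zero_of_ae (Eventually.of_forall fun u => ?_)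
  have hfix : MeasurableSet {y : F | (fun j => if h : j = i then y else
      f (u ⟨j, by simp only [t, mem_erase, mem_range]; exact ⟨fun e => h (Fin.ext e), j.2⟩⟩)) ∈ B} := by
    refine measurableSet_preimage ?_ hB
    refine measurable_pi_lambda _ fun j => ?_
    by_cases h : j = i
    · simp only [h, dite_true]; fun_prop
    · simp only [h, dite_false]; fun_prop
  have h1 := h0 _ hfix
  simp only [Pi.zero_apply]
  rw [← h1, (hid i).map_eq]
  refine Eq.trans ?_ (setIntegral_map (f := r) (g := Z 0) (hf hfix) hr.aestronglyMeasurable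
    (hZ 0).aemeasurable)
  rw [← integral_indicator (hf hfix)]
  rfl

end Prob

/-! ### Powers, inverses and ranks of matrices. -/

section Linalg

variable {m : Type*} [Fintype m] [DecidableEq m]

/-- The hypotheses make `A` symmetric and, tested on an eigenvector, put its eigenvalues strictly
between `-1` and `1`; diagonalise. -/
lemma tendsto_pow_zero_of_posDef {A : Matrix m m ℝ} (h1 : (1 - A).PosDef) (h2 : (1 + A).PosDef) :
    Tendsto (fun T : ℕ => A ^ T) atTop (𝓝 0) := by
  have hA : A.IsHermitian := by
    have := (isHermitian_one (n := m) (α := ℝ)).sub h1.isHermitian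
    simpa using this
  have hev : ∀ i, |hA.eigenvalues i| < 1 := by
    intro i
    have hv := hA.mulVec_eigenvectorBasis i
    set v : m → ℝ := ⇑(hA.eigenvectorBasis i) with hvdef
    have hv0 : v ≠ 0 := fun h => by
      have := hA.eigenvectorBasis.orthonormal.ne_zero i
      apply this; ext j; exact congrFun h j
    have e1 := h1.dotProduct_mulVec_pos hv0
    have e2 := h2.dotProduct_mulVec_pos hv0
    rw [sub_mulVec, one_mulVec, hv, dotProduct_sub, dotProduct_smul, smul_eq_mul] at e1
    rw [add_mulVec, one_mulVec, hv, dotProduct_add, dotProduct_smul, smul_eq_mul] at e2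
    have hpos : 0 < star v ⬝ᵥ v := by
      rw [dotProduct_comm]
      exact dotProduct_star_self_pos_iff.2 hv0
    rw [abs_lt]
    constructor <;> by_contra! hcon <;> nlinarith
  have hpow : ∀ T : ℕ, A ^ T = (hA.eigenvectorUnitary : Matrix m m ℝ) *
      diagonal (fun i => hA.eigenvalues i ^ T) *
        star (hA.eigenvectorUnitary : Matrix m m ℝ) := by
    intro T
    have hU : star (hA.eigenvectorUnitary : Matrix m m ℝ) * (hA.eigenvectorUnitary : Matrix m m ℝ)
      = 1 := Unitary.coe_star_mul_self _
    have hU' : (hA.eigenvectorUnitary : Matrix m m ℝ) * star (hA.eigenvectorUnitary : Matrix m m ℝ)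
      = 1 := Unitary.coe_mul_star_self _
    induction T with
    | zero => simp [hU']
    | succ T ih =>
      have hs : A = (hA.eigenvectorUnitary : Matrix m m ℝ) * diagonal hA.eigenvalues *
        star (hA.eigenvectorUnitary : Matrix m m ℝ) := by
        conv_lhs => rw [hA.spectral_theorem]
        rfl
      rw [pow_succ, ih]
      nth_rewrite 4 [hs]
      rw [show ∀ a b c d e f : Matrix m m ℝ, a * b * c * (d * e * f) = a * (b * (c * d) * e) * f
        from fun a b c d e f => by simp only [Matrix.mul_assoc], hU, Matrix.mul_one,
        diagonal_mul_diagonal]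
      simp only [pow_succ]
  simp only [hpow]
  have hd : Tendsto (fun T : ℕ => diagonal (fun i => hA.eigenvalues i ^ T)) atTop
      (𝓝 (diagonal fun _ => (0 : ℝ))) := by
    refine (Continuous.matrix_diagonal continuous_id).tendsto _ |>.comp ?_
    exact tendsto_pi_nhds.2 fun i => tendsto_pow_atTop_nhds_zero_of_abs_lt_one (hev i)
  have := (hd.const_mul (hA.eigenvectorUnitary : Matrix m m ℝ)).mul_const
    (star (hA.eigenvectorUnitary : Matrix m m ℝ))
  simpa using this

lemma measurable_matrix_det {Ω : Type*} {_ : MeasurableSpace Ω} {A : Ω → Matrix m m ℝ}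
    (hA : ∀ i j, Measurable fun ω => A ω i j) : Measurable fun ω => (A ω).det := by
  simp only [det_apply]
  exact Finset.measurable_sum _ fun p _ =>
    (Finset.measurable_prod _ fun i _ => hA _ _).const_smul (Equiv.Perm.sign p)

/-- The formula `A⁻¹ = (det A)⁻¹ adj A` also covers the default value at singular matrices, so no
invertibility is needed. -/
lemma measurable_matrix_inv {Ω : Type*} {_ : MeasurableSpace Ω} {A : Ω → Matrix m m ℝ}
    (hA : ∀ i j, Measurable fun ω => A ω i j) (i j : m) : Measurable fun ω => (A ω)⁻¹ i j := by
  simp only [Matrix.inv_def, Matrix.smul_apply, Ring.inverse_eq_inv', smul_eq_mul, adjugate_apply]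
  refine (measurable_matrix_det hA).inv.mul (measurable_matrix_det fun a b => ?_)
  by_cases h : a = j
  · simp [updateRow_apply, h]
  · simpa [updateRow_apply, h] using hA a b

omit [DecidableEq m] in
lemma measurable_mulVec {Ω l : Type*} {_ : MeasurableSpace Ω} {A : Ω → Matrix l m ℝ}
    {v : Ω → m → ℝ} (hA : ∀ i j, Measurable fun ω => A ω i j) (hv : ∀ j, Measurable fun ω => v ω j)
    (i : l) : Measurable fun ω => (A ω *ᵥ v ω) i := by
  simp only [mulVec, dotProduct]
  exact Finset.measurable_sum _ fun j _ => (hA i j).mul (hv j)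

lemma rank_eq_card_iff_det_ne_zero {A : Matrix m m ℝ} :
    A.rank = Fintype.card m ↔ A.det ≠ 0 := by
  constructor
  · intro h hdet
    have := exists_mulVec_eq_zero_iff.2 hdet
    obtain ⟨v, hv0, hv⟩ := this
    have hsurj : LinearMap.range A.mulVecLin = ⊤ := by
      apply Submodule.eq_top_of_finrank_eq
      rw [Module.finrank_fintype_fun_eq_card]; exact h
    have hinj := LinearMap.injective_iff_surjective.2 (LinearMap.range_eq_top.1 hsurj)
    exact hv0 (hinj (by simpa using hv))
  · intro h
    exact rank_of_isUnit _ ((isUnit_iff_isUnit_det A).2 (isUnit_iff_ne_zero.2 h))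

end Linalg

/-! ### Units as random vectors, their cells and residuals. -/

variable {Ω : Type*} {d K : ℕ}

/-- The values of a unit, `(X, W, Y(0), Y(1), H)`. -/
abbrev Obs (d K : ℕ) := (Fin d → ℝ) × Bool × ℝ × ℝ × Fin K

/-- The coefficients `(c(w), β(w))` of arm `w`. -/
def theta (c : Bool → ℝ) (β : Bool → Fin d → ℝ) (w : Bool) : Fin (d + 1) → ℝ :=
  Fin.cons (c w) (β w)

/-- `1` for the treated arm and `-1` for the control arm. -/
def armSign (w : Bool) : ℝ := if w then 1 else -1

namespace Obs

/-- Study and arm of a unit. -/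
def cell (z : Obs d K) : Fin K × Bool := (z.2.2.2.2, z.2.1)

/-- The observed outcome. -/
def outcome (z : Obs d K) : ℝ := if z.2.1 then z.2.2.2.1 else z.2.2.1

/-- The covariates with intercept. -/
def design (z : Obs d K) : Fin (d + 1) → ℝ := aug z.1

/-- The noise of the observed outcome. -/
def resid (c : Bool → ℝ) (β : Bool → Fin d → ℝ) (z : Obs d K) : ℝ :=
  outcome z - design z ⬝ᵥ theta c β z.2.1

/-- The expected effect of the treatment given the covariates. -/
def effect (c : Bool → ℝ) (β : Bool → Fin d → ℝ) (z : Obs d K) : ℝ :=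
  design z ⬝ᵥ (theta c β true - theta c β false)

/-- Indicator that the unit belongs to one of the cells in `A`. -/
def ind (A : Finset (Fin K × Bool)) (z : Obs d K) : ℝ := if cell z ∈ A then 1 else 0

/-- The features of a unit on which the assignment and the regression are based. -/
def features (z : Obs d K) : Fin K × Bool × (Fin d → ℝ) := (z.2.2.2.2, z.2.1, z.1)

lemma measurable_cell : Measurable (cell : Obs d K → _) := by unfold cell; fun_prop

lemma measurable_features : Measurable (features : Obs d K → _) := by unfold features; fun_prop

lemma measurable_outcome : Measurable (outcome : Obs d K → ℝ) := by
  unfold outcome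
  refine Measurable.ite ?_ (by fun_prop) (by fun_prop)
  exact (measurable_fst.comp measurable_snd) (measurableSet_singleton true)

lemma measurable_aug (a : Fin (d + 1)) : Measurable fun x : Fin d → ℝ => aug x a := by
  refine Fin.cases ?_ (fun j => ?_) a
  · simp [aug]
  · simpa [aug] using measurable_pi_apply j

lemma measurable_design (a : Fin (d + 1)) : Measurable fun z : Obs d K => design z a :=
  (measurable_aug a).comp measurable_fst

lemma measurable_design_dot {v : Obs d K → Fin (d + 1) → ℝ}
    (hv : ∀ a, Measurable fun z => v z a) : Measurable fun z : Obs d K => design z ⬝ᵥ v z := by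
  unfold dotProduct
  exact Finset.measurable_sum _ fun a _ => (measurable_design a).mul (hv a)

lemma measurable_cell_fun (f : Fin K × Bool → ℝ) : Measurable fun z : Obs d K => f (cell z) :=
  (measurable_of_finite f).comp measurable_cell

lemma measurable_ind (A : Finset (Fin K × Bool)) : Measurable (ind A : Obs d K → ℝ) :=
  measurable_cell_fun fun q => if q ∈ A then 1 else 0

lemma measurable_resid (c : Bool → ℝ) (β : Bool → Fin d → ℝ) :
    Measurable (resid c β : Obs d K → ℝ) :=
  measurable_outcome.sub
    (measurable_design_dot fun a => measurable_cell_fun fun q => theta c β q.2 a)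

lemma measurable_effect (c : Bool → ℝ) (β : Bool → Fin d → ℝ) :
    Measurable (effect c β : Obs d K → ℝ) := measurable_design_dot fun _ => measurable_const

end Obs

open Obs

/-! ### Exact error formulas and identities between the estimators. -/

namespace Units

variable (D : Units Ω d K)

/-- The values of unit `i`. -/
def obs (i : ℕ) (ω : Ω) : Obs d K :=
  (D.X i ω, D.W i ω, D.Y false i ω, D.Y true i ω, D.H i ω)

/-- Indices of the units in one of the cells in `A`. -/
def idx (n : ℕ) (A : Finset (Fin K × Bool)) (ω : Ω) : Finset ℕ :=
  {i ∈ range n | (D.H i ω, D.W i ω) ∈ A}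

lemma range_eq_idx (n : ℕ) (ω : Ω) : range n = D.idx n univ ω := by simp [idx]

lemma armIdx_eq_idx (n : ℕ) (w : Bool) (ω : Ω) :
    D.armIdx n w ω = D.idx n (univ ×ˢ {w}) ω := by
  ext i; simp only [idx, armIdx, mem_filter, mem_product, mem_univ, mem_singleton, true_and]

lemma studyIdx_eq_idx (n : ℕ) (k : Fin K) (ω : Ω) :
    D.studyIdx n k ω = D.idx n ({k} ×ˢ univ) ω := by
  ext i; simp only [idx, studyIdx, mem_filter, mem_product, mem_univ, mem_singleton, and_true]

lemma cellIdx_eq_idx (n : ℕ) (k : Fin K) (w : Bool) (ω : Ω) :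
    D.cellIdx n k w ω = D.idx n {(k, w)} ω := by simp [idx, cellIdx]

/-- Trading the random index set for an indicator turns subsample sums into sums of i.i.d. terms, to
which limit theorems and measurability lemmas apply. -/
lemma sum_idx {M : Type*} [AddCommMonoid M] [Module ℝ M] (n : ℕ) (A : Finset (Fin K × Bool))
    (ω : Ω) (f : ℕ → M) :
    ∑ i ∈ D.idx n A ω, f i = ∑ i ∈ range n, ind A (D.obs i ω) • f i := by
  rw [idx, Finset.sum_filter]
  refine Finset.sum_congr rfl fun i _ => ?_
  by_cases h : cell (D.obs i ω) ∈ A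
  · rw [ind, if_pos h, one_smul]
    exact if_pos h
  · rw [ind, if_neg h, zero_smul]
    exact if_neg h

lemma Yobs_eq (c : Bool → ℝ) (β : Bool → Fin d → ℝ) (i : ℕ) (ω : Ω) :
    D.Yobs i ω = aug (D.X i ω) ⬝ᵥ theta c β (D.W i ω) + resid c β (D.obs i ω) := by
  have : D.Yobs i ω = outcome (D.obs i ω) := by
    simp only [Yobs, outcome, obs]
    rcases Bool.eq_false_or_eq_true (D.W i ω) with h | h <;> simp [h]
  rw [this, resid]
  simp [obs, design]

/-- The sum of the covariates over cells. -/
def designSum (n : ℕ) (A : Finset (Fin K × Bool)) (ω : Ω) : Fin (d + 1) → ℝ :=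
  ∑ i ∈ D.idx n A ω, aug (D.X i ω)

/-- The score `∑ ε X'` over cells. -/
def score (c : Bool → ℝ) (β : Bool → Fin d → ℝ) (n : ℕ) (A : Finset (Fin K × Bool)) (ω : Ω) :
    Fin (d + 1) → ℝ :=
  ∑ i ∈ D.idx n A ω, resid c β (D.obs i ω) • aug (D.X i ω)

lemma designSum_apply (n : ℕ) (A : Finset (Fin K × Bool)) (ω : Ω) (a : Fin (d + 1)) :
    D.designSum n A ω a = ∑ i ∈ range n, ind A (D.obs i ω) * design (D.obs i ω) a := by
  simp [designSum, sum_idx, Finset.sum_apply, obs, design]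

lemma score_apply (c : Bool → ℝ) (β : Bool → Fin d → ℝ) (n : ℕ) (A : Finset (Fin K × Bool))
    (ω : Ω) (a : Fin (d + 1)) :
    D.score c β n A ω a = ∑ i ∈ range n,
      ind A (D.obs i ω) * (design (D.obs i ω) a * resid c β (D.obs i ω)) := by
  simp [score, sum_idx, Finset.sum_apply, obs, design, mul_comm]

lemma gram_idx_apply (n : ℕ) (A : Finset (Fin K × Bool)) (ω : Ω) (a b : Fin (d + 1)) :
    D.gram (D.idx n A ω) ω a b = ∑ i ∈ range n,
      ind A (D.obs i ω) * (design (D.obs i ω) a * design (D.obs i ω) b) := by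
  simp [gram, sum_idx, Matrix.sum_apply, vecMulVec_apply, obs, design]

lemma gram_mulVec (s : Finset ℕ) (ω : Ω) (v : Fin (d + 1) → ℝ) :
    D.gram s ω *ᵥ v = ∑ i ∈ s, (aug (D.X i ω) ⬝ᵥ v) • aug (D.X i ω) := by
  simp only [gram, sum_mulVec, vecMulVec_mulVec]
  refine Finset.sum_congr rfl fun i _ => ?_
  ext a; simp [mul_comm]

/-- All cells of `A` lie in one arm, so a single coefficient vector generates the outcomes and the
right side of the normal equations is `G θ + score`. -/
lemma ols_eq {c : Bool → ℝ} {β : Bool → Fin d → ℝ} {n : ℕ} {A : Finset (Fin K × Bool)}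
    {w : Bool} (hA : ∀ q ∈ A, q.2 = w) {ω : Ω} (h : (D.gram (D.idx n A ω) ω).det ≠ 0) :
    D.ols (D.idx n A ω) ω =
      theta c β w + (D.gram (D.idx n A ω) ω)⁻¹ *ᵥ D.score c β n A ω := by
  have h1 : ∑ i ∈ D.idx n A ω, D.Yobs i ω • aug (D.X i ω) =
      D.gram (D.idx n A ω) ω *ᵥ theta c β w + D.score c β n A ω := by
    rw [gram_mulVec, score, ← Finset.sum_add_distrib]
    refine Finset.sum_congr rfl fun i hi => ?_
    have hw : D.W i ω = w := hA _ (Finset.mem_filter.1 hi).2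
    rw [D.Yobs_eq c β, hw, add_smul]
  rw [ols, h1, mulVec_add, mulVec_mulVec, nonsing_inv_mul _ (isUnit_iff_ne_zero.2 h), one_mulVec]

lemma gFormula_eq (s : Finset ℕ) (θ : Bool → Fin (d + 1) → ℝ) (ω : Ω) :
    D.gFormula s θ ω = (∑ i ∈ s, aug (D.X i ω) ⬝ᵥ (θ true - θ false)) / (s.card : ℝ) := by
  simp [gFormula, dotProduct_sub]

/-- The weight `n_k / n` cancels the normalisation by `n_k`; for an empty study both sides are zero.
-/
lemma studyFrac_mul_gFormula (n : ℕ) (k : Fin K) (θ : Bool → Fin (d + 1) → ℝ) (ω : Ω) :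
    D.studyFrac n k ω * D.gFormula (D.studyIdx n k ω) θ ω =
      (∑ i ∈ D.studyIdx n k ω, aug (D.X i ω) ⬝ᵥ (θ true - θ false)) / n := by
  rw [gFormula_eq, studyFrac]
  rcases (D.studyIdx n k ω).eq_empty_or_nonempty with h | h
  · simp [h]
  · have : ((D.studyIdx n k ω).card : ℝ) ≠ 0 := by exact_mod_cast h.card_pos.ne'
    field_simp

lemma sum_studyIdx {M : Type*} [AddCommMonoid M] (n : ℕ) (ω : Ω) (f : ℕ → M) :
    ∑ k, ∑ i ∈ D.studyIdx n k ω, f i = ∑ i ∈ range n, f i :=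
  Finset.sum_fiberwise (range n) (fun i => D.H i ω) f

lemma sum_cellIdx {M : Type*} [AddCommMonoid M] (n : ℕ) (w : Bool) (ω : Ω) (f : ℕ → M) :
    ∑ k, ∑ i ∈ D.cellIdx n k w ω, f i = ∑ i ∈ D.armIdx n w ω, f i := by
  rw [← Finset.sum_fiberwise (D.armIdx n w ω) (fun i => D.H i ω) f]
  refine Finset.sum_congr rfl fun k _ => Finset.sum_congr ?_ fun _ _ => rfl
  ext i; simp only [cellIdx, armIdx, Finset.mem_filter]; tauto

/-- With common coefficients, sample-size weights restore the average over everybody. Federated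
estimators therefore differ from the pooled one only through their coefficients. -/
lemma federated_eq (n : ℕ) (θ : Bool → Fin (d + 1) → ℝ) (ω : Ω) :
    D.federated n θ ω = D.gFormula (range n) θ ω := by
  simp only [federated, studyFrac_mul_gFormula]
  rw [← Finset.sum_div, sum_studyIdx, gFormula_eq, card_range]

lemma sampleEffect_eq (c : Bool → ℝ) (β : Bool → Fin d → ℝ) (n : ℕ) (ω : Ω) :
    D.sampleEffect c β n ω = (∑ i ∈ range n, effect c β (D.obs i ω)) / n := by
  rw [sampleEffect, gFormula_eq, card_range]
  rfl

lemma tauGivenH_eq [MeasurableSpace Ω] (P : Measure Ω) (n : ℕ) (ω : Ω) :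
    D.tauGivenH P n ω = (∑ i ∈ range n, D.tauStudy P (cell (D.obs i ω)).1) / n := by
  rw [← D.sum_studyIdx n ω, tauGivenH, Finset.sum_div]
  refine Finset.sum_congr rfl fun k _ => ?_
  rw [studyFrac, Finset.sum_congr rfl (g := fun _ => D.tauStudy P k)]
  · simp; ring
  · intro i hi
    rw [show (cell (D.obs i ω)).1 = D.H i ω from rfl, (Finset.mem_filter.1 hi).2]

/-- The error of the pooled estimator. -/
lemma tauPool_eq (c : Bool → ℝ) (β : Bool → Fin d → ℝ) {n : ℕ} {ω : Ω}
    (h : ∀ w, (D.gram (D.armIdx n w ω) ω).det ≠ 0) :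
    D.tauPool n ω = D.sampleEffect c β n ω + ∑ w, armSign w * ((n : ℝ)⁻¹ *
      (D.designSum n univ ω ⬝ᵥ
        ((D.gram (D.idx n (univ ×ˢ {w}) ω) ω)⁻¹ *ᵥ D.score c β n (univ ×ˢ {w}) ω))) := by
  have h1 : ∀ w, D.ols (D.armIdx n w ω) ω = theta c β w +
      (D.gram (D.idx n (univ ×ˢ {w}) ω) ω)⁻¹ *ᵥ D.score c β n (univ ×ˢ {w}) ω := by
    intro w
    rw [armIdx_eq_idx]
    refine D.ols_eq (fun q hq => ?_) ?_
    · exact mem_singleton.1 (mem_product.1 hq).2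
    · rw [← armIdx_eq_idx]; exact h w
  rw [tauPool, gFormula_eq, card_range, sampleEffect_eq]
  simp only [h1]
  generalize (fun w => (D.gram (D.idx n (univ ×ˢ {w}) ω) ω)⁻¹ *ᵥ
    D.score c β n (univ ×ˢ {w}) ω) = u
  simp only [add_sub_add_comm, dotProduct_add, Finset.sum_add_distrib, add_div]
  congr 1
  rw [← sum_dotProduct, designSum, ← range_eq_idx]
  simp [armSign, dotProduct_sub]
  ring

/-- The error of the meta-analysis. -/
lemma tauMetaSW_eq (c : Bool → ℝ) (β : Bool → Fin d → ℝ) {n : ℕ} {ω : Ω}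
    (h : ∀ k w, (D.gram (D.cellIdx n k w ω) ω).det ≠ 0) :
    D.tauMetaSW n ω = D.sampleEffect c β n ω + ∑ q : Fin K × Bool, armSign q.2 * ((n : ℝ)⁻¹ *
      (D.designSum n ({q.1} ×ˢ univ) ω ⬝ᵥ
        ((D.gram (D.idx n {q} ω) ω)⁻¹ *ᵥ D.score c β n {q} ω))) := by
  have h1 : ∀ k w, D.ols (D.cellIdx n k w ω) ω = theta c β w +
      (D.gram (D.idx n {(k, w)} ω) ω)⁻¹ *ᵥ D.score c β n {(k, w)} ω := by
    intro k w
    rw [cellIdx_eq_idx]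
    refine D.ols_eq (fun q hq => ?_) ?_
    · rw [Finset.mem_singleton.1 hq]
    · rw [← cellIdx_eq_idx]; exact h k w
  simp only [tauMetaSW, tauLocal, studyFrac_mul_gFormula, h1]
  rw [Fintype.sum_prod_type, sampleEffect_eq, ← D.sum_studyIdx n ω, Finset.sum_div,
    ← Finset.sum_add_distrib]
  refine Finset.sum_congr rfl fun k _ => ?_
  generalize (fun w => (D.gram (D.idx n {(k, w)} ω) ω)⁻¹ *ᵥ D.score c β n {(k, w)} ω) = u
  simp only [add_sub_add_comm, dotProduct_add, Finset.sum_add_distrib, add_div]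
  congr 1
  rw [← sum_dotProduct, designSum, ← studyIdx_eq_idx]
  simp [armSign, dotProduct_sub]
  ring

lemma localFullRank_iff (n : ℕ) (ω : Ω) :
    D.LocalFullRank n ω ↔ ∀ k w, (D.gram (D.cellIdx n k w ω) ω).det ≠ 0 := by
  have := fun k w => rank_eq_card_iff_det_ne_zero (A := D.gram (D.cellIdx n k w ω) ω)
  simp only [Fintype.card_fin] at this
  simp [LocalFullRank, this]

lemma sum_gram_cellIdx (n : ℕ) (w : Bool) (ω : Ω) :
    ∑ k, D.gram (D.cellIdx n k w ω) ω = D.gram (D.armIdx n w ω) ω :=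
  D.sum_cellIdx n w ω _

lemma gram_mulVec_ols {s : Finset ℕ} {ω : Ω} (h : (D.gram s ω).det ≠ 0) :
    D.gram s ω *ᵥ D.ols s ω = ∑ i ∈ s, D.Yobs i ω • aug (D.X i ω) := by
  rw [ols, mulVec_mulVec, mul_nonsing_inv _ (isUnit_iff_ne_zero.2 h), one_mulVec]

lemma inv_smul_of_det_ne_zero {r : ℝ} (hr : r ≠ 0) {A : Matrix (Fin (d + 1)) (Fin (d + 1)) ℝ}
    (hA : A.det ≠ 0) : (r • A)⁻¹ = r⁻¹ • A⁻¹ := by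
  refine inv_eq_left_inv ?_
  rw [Matrix.smul_mul, Matrix.mul_smul, smul_smul, inv_mul_cancel₀ hr, one_smul,
    nonsing_inv_mul _ (isUnit_iff_ne_zero.2 hA)]

/-- The precision matrix of a local fit is `σ⁻² G_k`, so precision times estimate is `σ⁻² X'ᵀY` of
the cell. Both add up over the studies to the pooled normal equations, and `σ` cancels. -/
lemma tauIVW_eq_tauPool {σ : ℝ} (hσ : 0 < σ) {n : ℕ} {ω : Ω}
    (h : ∀ k w, (D.gram (D.cellIdx n k w ω) ω).det ≠ 0)
    (h' : ∀ w, (D.gram (D.armIdx n w ω) ω).det ≠ 0) : D.tauIVW σ n ω = D.tauPool n ω := by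
  rw [tauIVW, tauPool, federated_eq]
  congr 1
  funext w
  have hσ2 : (σ ^ 2) ≠ 0 := by positivity
  have hinv : ∀ k, (D.localVar σ n k w ω)⁻¹ = (σ ^ 2)⁻¹ • D.gram (D.cellIdx n k w ω) ω := by
    intro k
    have hd := isUnit_iff_ne_zero.2 (h k w)
    rw [localVar, inv_smul_of_det_ne_zero hσ2, nonsing_inv_nonsing_inv _ hd]
    rw [det_nonsing_inv]
    simpa using h k w
  simp only [thetaIVW, hinv, smul_mulVec, D.gram_mulVec_ols (h _ w), ← Finset.smul_sum]
  rw [D.sum_gram_cellIdx, D.sum_cellIdx n w ω, inv_smul_of_det_ne_zero (inv_ne_zero hσ2) (h' w),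
    smul_mulVec, mulVec_smul, smul_smul, inv_mul_cancel₀ (inv_ne_zero hσ2), one_smul]
  rfl

/-- One round of FedAvg with one local step is a gradient step for the pooled loss. -/
lemma fedAvgRound_one (n : ℕ) (w : Bool) (ω : Ω) (η : ℝ) (θ : Fin (d + 1) → ℝ) :
    D.fedAvgRound n w ω η 1 θ =
      (((D.armIdx n w ω).card : ℝ) / (D.armIdx n w ω).card) • θ +
        (η * (2 / (D.armIdx n w ω).card)) •
          ((∑ i ∈ D.armIdx n w ω, D.Yobs i ω • aug (D.X i ω)) -
            D.gram (D.armIdx n w ω) ω *ᵥ θ) := by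
  have hgrad : ∀ s : Finset ℕ, D.lossGrad s ω θ = -(2 / (s.card : ℝ)) •
      ((∑ i ∈ s, D.Yobs i ω • aug (D.X i ω)) - D.gram s ω *ᵥ θ) := by
    intro s
    rw [lossGrad, gram_mulVec, ← Finset.sum_sub_distrib]
    simp only [sub_smul]
  have hcard : ((D.armIdx n w ω).card : ℝ) = ∑ k, ((D.cellIdx n k w ω).card : ℝ) := by
    have := D.sum_cellIdx n w ω fun _ => (1 : ℝ)
    simpa using this.symm
  simp only [fedAvgRound, localUpdate, Function.iterate_one, hgrad]
  rw [← D.sum_cellIdx n w ω, ← sum_gram_cellIdx]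
  generalize ((D.armIdx n w ω).card : ℝ) = N at *
  conv_rhs => rw [hcard, Finset.sum_div, Finset.sum_smul, sum_mulVec, ← Finset.sum_sub_distrib,
    Finset.smul_sum, ← Finset.sum_add_distrib]
  refine Finset.sum_congr rfl fun k _ => ?_
  rw [← hcard]
  -- An empty cell contributes zero to both sides; otherwise its averaging weight cancels the `1 /
  -- n_k` in the local gradient.
  rcases (D.cellIdx n k w ω).eq_empty_or_nonempty with h0 | h0
  · simp [h0, gram]
  · have hk : ((D.cellIdx n k w ω).card : ℝ) ≠ 0 := by exact_mod_cast h0.card_pos.ne'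
    rw [neg_smul, smul_neg, sub_neg_eq_add, smul_add, smul_smul, smul_smul]
    congr 2
    field_simp

lemma gram_posSemidef (s : Finset ℕ) (ω : Ω) : (D.gram s ω).PosSemidef := by
  rw [gram]
  refine posSemidef_sum _ fun i _ => ?_
  simpa using posSemidef_vecMulVec_self_star (aug (D.X i ω))

/-- Each round multiplies the distance to the least squares solution by `A = 1 - η Hess`. Here `1 -
A = η Hess` is positive definite because the Gram matrix is invertible, and `1 + A = 2 - η Hess` is
so by the condition on the learning rate; hence `A ^ T → 0`. -/
lemma tendsto_fedAvg {n : ℕ} {w : Bool} {ω : Ω} {η : ℝ} (hη : 0 < η)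
    (hη2 : ((2 : ℝ) • (1 : Matrix (Fin (d + 1)) (Fin (d + 1)) ℝ) -
      η • D.lossHess n w ω).PosDef)
    (h : (D.gram (D.armIdx n w ω) ω).det ≠ 0) (θ₀ : Fin (d + 1) → ℝ) :
    Tendsto (fun T : ℕ => D.fedAvg n w ω η 1 T θ₀) atTop (𝓝 (D.ols (D.armIdx n w ω) ω)) := by
  set s := D.armIdx n w ω with hs
  set θs := D.ols s ω
  -- An empty arm has zero Gram matrix, of size `d + 1 > 0`, hence zero determinant.
  have hne : s.Nonempty := by
    rw [Finset.nonempty_iff_ne_empty]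
    intro h0
    apply h
    rw [h0, gram, Finset.sum_empty, det_zero]
  have hN : (0 : ℝ) < s.card := by exact_mod_cast hne.card_pos
  set A := (1 : Matrix (Fin (d + 1)) (Fin (d + 1)) ℝ) - η • D.lossHess n w ω with hA
  have hround : ∀ θ, D.fedAvgRound n w ω η 1 θ - θs = A *ᵥ (θ - θs) := by
    intro θ
    rw [fedAvgRound_one, ← hs, div_self hN.ne', ← D.gram_mulVec_ols h, one_smul, hA, lossHess,
      ← hs, sub_mulVec, one_mulVec, smul_mulVec, smul_mulVec, mulVec_sub, smul_smul]
    rw [← neg_sub (D.gram s ω *ᵥ θ), smul_neg]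
    abel
  have hT : ∀ T : ℕ, D.fedAvg n w ω η 1 T θ₀ = A ^ T *ᵥ (θ₀ - θs) + θs := by
    intro T
    induction T with
    | zero => simp [fedAvg]
    | succ T ih =>
      rw [fedAvg, Function.iterate_succ_apply', ← fedAvg, ← sub_eq_iff_eq_add, hround, ih,
        add_sub_cancel_right, mulVec_mulVec, pow_succ']
  have hpow : Tendsto (fun T : ℕ => A ^ T) atTop (𝓝 0) := by
    refine tendsto_pow_zero_of_posDef ?_ ?_
    · rw [hA, sub_sub_cancel, lossHess, ← hs, smul_smul]
      have hpd : (D.gram s ω).PosDef :=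
        (D.gram_posSemidef s ω).posDef_iff_isUnit.2
          ((isUnit_iff_isUnit_det _).2 (isUnit_iff_ne_zero.2 h))
      exact hpd.smul (by positivity)
    · convert hη2 using 1
      rw [hA, two_smul]; abel
  have hcont : Continuous fun M : Matrix (Fin (d + 1)) (Fin (d + 1)) ℝ =>
      M *ᵥ (θ₀ - θs) + θs := by fun_prop
  have := (hcont.tendsto 0).comp hpow
  simp only [zero_mulVec, zero_add] at this
  exact this.congr fun T => (hT T).symm

lemma tauGD_eq_tauPool [MeasurableSpace Ω] {η : ℕ → Bool → Ω → ℝ} (hη : D.IsLearningRate η)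
    (θ₀ : Bool → Fin (d + 1) → ℝ) {n : ℕ} {ω : Ω}
    (h : ∀ w, (D.gram (D.armIdx n w ω) ω).det ≠ 0) : D.tauGD η θ₀ n ω = D.tauPool n ω := by
  rw [tauGD, tauPool, federated_eq]
  congr 1
  funext w
  exact (D.tendsto_fedAvg (hη.2 n w ω).1 (hη.2 n w ω).2 (h w) (θ₀ w)).limUnder_eq

end Units

/-! ### Measurability of the estimators. -/

namespace Units

variable (D : Units Ω d K)

section Measurability

variable {mΩ : MeasurableSpace Ω}

/-- The σ-algebra is left open and only units `i < n` are constrained, so that this serves both the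
ambient σ-algebra and `designSigma n`, as do the lemmas built on it. -/
lemma measurable_sum_feature {n : ℕ} (hF : ∀ i < n, Measurable fun ω => features (D.obs i ω))
    {g : Fin K × Bool × (Fin d → ℝ) → ℝ} (hg : Measurable g) :
    Measurable fun ω => ∑ i ∈ range n, g (features (D.obs i ω)) :=
  Finset.measurable_sum _ fun i hi => hg.comp (hF i (mem_range.1 hi))

lemma measurable_designSum {n : ℕ} (hF : ∀ i < n, Measurable fun ω => features (D.obs i ω))
    (A : Finset (Fin K × Bool)) (a : Fin (d + 1)) :
    Measurable fun ω => D.designSum n A ω a := by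
  simp only [designSum_apply]
  refine D.measurable_sum_feature hF
    (g := fun y => (if (y.1, y.2.1) ∈ A then 1 else 0) * aug y.2.2 a) ?_
  refine Measurable.mul ?_ ((measurable_aug a).comp (by fun_prop))
  exact (measurable_of_finite fun q : Fin K × Bool => if q ∈ A then (1 : ℝ) else 0).comp
    (by fun_prop : Measurable fun y : Fin K × Bool × (Fin d → ℝ) => (y.1, y.2.1))

lemma measurable_gram_idx {n : ℕ} (hF : ∀ i < n, Measurable fun ω => features (D.obs i ω))
    (A : Finset (Fin K × Bool)) (a b : Fin (d + 1)) :
    Measurable fun ω => D.gram (D.idx n A ω) ω a b := by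
  simp only [gram_idx_apply]
  refine D.measurable_sum_feature hF
    (g := fun y => (if (y.1, y.2.1) ∈ A then 1 else 0) * (aug y.2.2 a * aug y.2.2 b)) ?_
  refine Measurable.mul ?_ (((measurable_aug a).comp (by fun_prop)).mul
    ((measurable_aug b).comp (by fun_prop)))
  exact (measurable_of_finite fun q : Fin K × Bool => if q ∈ A then (1 : ℝ) else 0).comp
    (by fun_prop : Measurable fun y : Fin K × Bool × (Fin d → ℝ) => (y.1, y.2.1))

lemma measurable_features_designSigma {n i : ℕ} (hi : i < n) :
    Measurable[D.designSigma n] fun ω => features (D.obs i ω) := by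
  have h : Measurable[D.designSigma n] fun ω (j : Fin n) => (D.H j ω, D.W j ω, D.X j ω) :=
    comap_measurable _
  exact (measurable_pi_apply (⟨i, hi⟩ : Fin n)).comp h

lemma measurableSet_localFullRank {n : ℕ}
    (hF : ∀ i < n, Measurable fun ω => features (D.obs i ω)) :
    MeasurableSet {ω | D.LocalFullRank n ω} := by
  simp only [localFullRank_iff, Set.ofPred_forall]
  refine MeasurableSet.iInter fun k => MeasurableSet.iInter fun w => ?_
  refine (measurable_matrix_det fun a b => ?_) (measurableSet_singleton (0 : ℝ)).compl
  simp only [cellIdx_eq_idx]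
  exact D.measurable_gram_idx hF _ a b

variable (hD : ∀ i, Measurable (D.obs i))

include hD

lemma measurable_designSum' (n : ℕ) (A : Finset (Fin K × Bool)) (a : Fin (d + 1)) :
    Measurable fun ω => D.designSum n A ω a :=
  D.measurable_designSum (fun i _ => measurable_features.comp (hD i)) A a

lemma measurable_gram_idx' (n : ℕ) (A : Finset (Fin K × Bool)) (a b : Fin (d + 1)) :
    Measurable fun ω => D.gram (D.idx n A ω) ω a b :=
  D.measurable_gram_idx (fun i _ => measurable_features.comp (hD i)) A a b

lemma measurable_sum_Yobs (n : ℕ) (A : Finset (Fin K × Bool)) (a : Fin (d + 1)) :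
    Measurable fun ω => (∑ i ∈ D.idx n A ω, D.Yobs i ω • aug (D.X i ω)) a := by
  have h : ∀ ω, (∑ i ∈ D.idx n A ω, D.Yobs i ω • aug (D.X i ω)) a = ∑ i ∈ range n,
      ind A (D.obs i ω) * (outcome (D.obs i ω) * design (D.obs i ω) a) := by
    intro ω
    simp only [sum_idx, Finset.sum_apply, Pi.smul_apply, smul_eq_mul]
    refine Finset.sum_congr rfl fun i _ => ?_
    congr 2
    simp only [Yobs, outcome, obs]
    rcases Bool.eq_false_or_eq_true (D.W i ω) with h | h <;> simp [h]
  simp only [h]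
  exact Finset.measurable_sum _ fun i _ => ((measurable_ind A).comp (hD i)).mul
    ((measurable_outcome.comp (hD i)).mul ((measurable_design a).comp (hD i)))

lemma measurable_ols_idx (n : ℕ) (A : Finset (Fin K × Bool)) (a : Fin (d + 1)) :
    Measurable fun ω => D.ols (D.idx n A ω) ω a :=
  measurable_mulVec (measurable_matrix_inv (D.measurable_gram_idx' hD n A))
    (D.measurable_sum_Yobs hD n A) a

lemma measurable_sum_idx (n : ℕ) (A : Finset (Fin K × Bool)) {f : ℕ → Ω → ℝ}
    (hf : ∀ i, Measurable (f i)) : Measurable fun ω => ∑ i ∈ D.idx n A ω, f i ω := by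
  simp only [sum_idx, smul_eq_mul]
  exact Finset.measurable_sum _ fun i _ => ((measurable_ind A).comp (hD i)).mul (hf i)

lemma measurable_card_idx (n : ℕ) (A : Finset (Fin K × Bool)) :
    Measurable fun ω => ((D.idx n A ω).card : ℝ) := by
  have := D.measurable_sum_idx hD n A (f := fun _ _ => 1) fun _ => measurable_const
  simpa using this

lemma measurable_gFormula_idx (n : ℕ) (A : Finset (Fin K × Bool))
    {θ : Bool → Ω → Fin (d + 1) → ℝ} (hθ : ∀ w a, Measurable fun ω => θ w ω a) :
    Measurable fun ω => D.gFormula (D.idx n A ω) (fun w => θ w ω) ω := by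
  simp only [gFormula_eq]
  refine (D.measurable_sum_idx hD n A fun i => ?_).div (D.measurable_card_idx hD n A)
  simp only [dotProduct, Pi.sub_apply]
  exact Finset.measurable_sum _ fun a _ =>
    ((measurable_design a).comp (hD i)).mul ((hθ true a).sub (hθ false a))

lemma measurable_studyFrac (n : ℕ) (k : Fin K) : Measurable (D.studyFrac n k) := by
  have e : D.studyFrac n k = fun ω => ((D.idx n ({k} ×ˢ univ) ω).card : ℝ) / n := by
    funext ω
    rw [studyFrac, studyIdx_eq_idx]
  rw [e]
  exact (D.measurable_card_idx hD n _).div_const _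

lemma measurable_federated (n : ℕ)
    {θ : Bool → Ω → Fin (d + 1) → ℝ} (hθ : ∀ w a, Measurable fun ω => θ w ω a) :
    Measurable fun ω => D.federated n (fun w => θ w ω) ω := by
  have := D.measurable_gFormula_idx hD n univ hθ
  simp only [← range_eq_idx] at this
  simpa only [federated_eq] using this

lemma measurable_tauPool (n : ℕ) : Measurable (D.tauPool n) := by
  have e : ∀ ω, D.tauPool n ω =
      D.federated n (fun w => D.ols (D.idx n (univ ×ˢ {w}) ω) ω) ω := by
    intro ω
    rw [tauPool, federated_eq]
    simp only [armIdx_eq_idx]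
  have hols : ∀ w a, Measurable fun ω => D.ols (D.idx n (univ ×ˢ {w}) ω) ω a :=
    fun w a => D.measurable_ols_idx hD n _ a
  have h := D.measurable_federated hD n hols
  rwa [← funext e] at h

lemma measurable_tauMetaSW (n : ℕ) : Measurable (D.tauMetaSW n) := by
  unfold tauMetaSW
  refine Finset.measurable_sum _ fun k _ => Measurable.mul (D.measurable_studyFrac hD n k) ?_
  have e : D.tauLocal n k = fun ω => D.gFormula (D.idx n ({k} ×ˢ univ) ω)
      (fun w => D.ols (D.idx n {(k, w)} ω) ω) ω := by
    funext ω
    rw [tauLocal, studyIdx_eq_idx]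
    simp only [cellIdx_eq_idx]
  rw [e]
  exact D.measurable_gFormula_idx hD n _ (θ := fun w ω => D.ols (D.idx n {(k, w)} ω) ω)
      fun w a => D.measurable_ols_idx hD n _ a

lemma measurable_tauIVW (σ : ℝ) (n : ℕ) : Measurable (D.tauIVW σ n) := by
  refine D.measurable_federated hD n (θ := fun w ω => D.thetaIVW σ n ω w) fun w a => ?_
  have hV : ∀ k a b, Measurable fun ω => (D.localVar σ n k w ω)⁻¹ a b := by
    intro k
    refine measurable_matrix_inv fun a b => ?_
    simp only [localVar, cellIdx_eq_idx, Matrix.smul_apply]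
    exact (measurable_matrix_inv (D.measurable_gram_idx' hD n _) a b).const_smul (σ ^ 2)
  refine measurable_mulVec (measurable_matrix_inv fun a b => ?_) (fun a => ?_) a
  · simp only [Matrix.sum_apply]
    exact Finset.measurable_sum _ fun k _ => hV k a b
  · simp only [Finset.sum_apply]
    refine Finset.measurable_sum _ fun k _ => measurable_mulVec (hV k) (fun b => ?_) a
    simp only [cellIdx_eq_idx]
    exact D.measurable_ols_idx hD n _ b

/-- Every iterate is measurable, and `limUnder` of measurable functions is measurable even where
there is no convergence; full rank plays no role. -/
lemma measurable_tauGD {η : ℕ → Bool → Ω → ℝ} (hη : ∀ n w, Measurable (η n w))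
    (θ₀ : Bool → Fin (d + 1) → ℝ) (n : ℕ) : Measurable (D.tauGD η θ₀ n) := by
  refine D.measurable_federated hD n (θ := fun w ω => D.thetaGD η θ₀ n ω w) fun w a => ?_
  have hT : ∀ T a, Measurable fun ω => D.fedAvg n w ω (η n w ω) 1 T (θ₀ w) a := by
    intro T
    induction T with
    | zero => intro a; exact measurable_const
    | succ T ih =>
      intro a
      have hc : Measurable fun ω => ((D.armIdx n w ω).card : ℝ) := by
        simp only [armIdx_eq_idx]; exact D.measurable_card_idx hD n _
      simp only [fedAvg, Function.iterate_succ_apply'] at ih ⊢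
      -- The one-round formula retains the factor `n(w) / n(w)`, which is `0` for an empty arm, and
      -- so holds at every `ω`.
      simp only [fedAvgRound_one, Pi.add_apply, Pi.smul_apply, Pi.sub_apply, smul_eq_mul]
      refine ((hc.div hc).mul (ih a)).add (((hη n w).mul (hc.const_div 2)).mul (Measurable.sub ?_ ?_))
      · simp only [armIdx_eq_idx]; exact D.measurable_sum_Yobs hD n _ a
      · refine measurable_mulVec (fun b b' => ?_) ih a
        simp only [armIdx_eq_idx]; exact D.measurable_gram_idx' hD n _ b b'
  have h : Measurable fun ω => D.thetaGD η θ₀ n ω w :=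
    (StronglyMeasurable.limUnder (l := atTop) fun T =>
      (measurable_pi_lambda _ (hT T)).stronglyMeasurable).measurable
  exact (measurable_pi_apply a).comp h

lemma measurable_tauGivenH (P : Measure Ω) (n : ℕ) : Measurable (D.tauGivenH P n) := by
  unfold tauGivenH
  exact Finset.measurable_sum _ fun k _ => (D.measurable_studyFrac hD n k).mul_const _

end Measurability

end Units

lemma aug_dotProduct_cons (x : Fin d → ℝ) (v : Fin (d + 1) → ℝ) :
    aug x ⬝ᵥ v = v 0 + x ⬝ᵥ (fun j => v j.succ) := by
  simp [aug, dotProduct, Fin.sum_univ_succ]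

/-! ### Randomisation and conditional moments of the noise. -/

namespace Units

variable (D : Units Ω d K) [MeasurableSpace Ω] (P : Measure Ω)

/-- The probability of arm `q.2` in study `q.1`. -/
noncomputable def armProb (q : Fin K × Bool) : ℝ :=
  if q.2 then D.treatProb P q.1 else 1 - D.treatProb P q.1

/-- The covariates and potential outcomes of the first unit. -/
def potential (ω : Ω) : (Fin d → ℝ) × ℝ × ℝ := (D.X 0 ω, D.Y false 0 ω, D.Y true 0 ω)

/-- The noise in arm `w`. -/
def potentialNoise (c : Bool → ℝ) (β : Bool → Fin d → ℝ) (w : Bool)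
    (y : (Fin d → ℝ) × ℝ × ℝ) : ℝ :=
  (if w then y.2.2 else y.2.1) - aug y.1 ⬝ᵥ theta c β w

omit [MeasurableSpace Ω] in
lemma noise_eq (c : Bool → ℝ) (β : Bool → Fin d → ℝ) (w : Bool) (ω : Ω) :
    D.noise c β w 0 ω = potentialNoise c β w (D.potential ω) := by
  have : (fun j : Fin d => (theta c β w) j.succ) = β w := by ext j; simp [theta]
  simp only [noise, potentialNoise, potential, aug_dotProduct_cons, this]
  cases w <;> simp [theta] <;> ring

lemma measurable_potentialNoise (c : Bool → ℝ) (β : Bool → Fin d → ℝ) (w : Bool) :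
    Measurable (potentialNoise c β w) := by
  unfold potentialNoise dotProduct
  refine Measurable.sub (by cases w <;> simp <;> fun_prop) ?_
  exact Finset.measurable_sum _ fun a _ =>
    ((measurable_aug a).comp measurable_fst).mul_const _

variable {D P} {c : Bool → ℝ} {β : Bool → Fin d → ℝ} {σ : ℝ}

namespace IsCovariateShiftModel

section

variable (hD : D.IsCovariateShiftModel P c β σ)
include hD

lemma measurable_obs (i : ℕ) : Measurable (D.obs i) :=
  (hD.measurable_X i).prodMk ((hD.measurable_W i).prodMk ((hD.measurable_Y false i).prodMk
    ((hD.measurable_Y true i).prodMk (hD.measurable_H i))))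

lemma measurable_potential : Measurable D.potential :=
  (hD.measurable_X 0).prodMk ((hD.measurable_Y false 0).prodMk (hD.measurable_Y true 0))

lemma measurableSet_study (k : Fin K) : MeasurableSet (D.H 0 ⁻¹' {k}) :=
  hD.measurable_H 0 (measurableSet_singleton k)

lemma iIndepFun_obs : iIndepFun D.obs P := hD.indep

lemma identDistrib_obs (i : ℕ) : IdentDistrib (D.obs i) (D.obs 0) P P := hD.identDistrib i

lemma armProb_pos (q : Fin K × Bool) : 0 < D.armProb P q := by
  unfold armProb
  have h1 := hD.treatProb_pos q.1
  have h2 := hD.treatProb_lt_one q.1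
  split_ifs <;> linarith

variable [IsProbabilityMeasure P]

lemma isProbabilityMeasure_studyMeasure (k : Fin K) :
    IsProbabilityMeasure (D.studyMeasure P k) := by
  refine cond_isProbabilityMeasure fun h => ?_
  have := hD.rho_pos k
  simp [rho, Measure.real, h] at this

omit hD [IsProbabilityMeasure P] in
lemma integral_studyMeasure (k : Fin K) (f : Ω → ℝ) :
    ∫ ω, f ω ∂(D.studyMeasure P k) = (D.rho P k)⁻¹ * ∫ ω in D.H 0 ⁻¹' {k}, f ω ∂P := by
  rw [studyMeasure, ProbabilityTheory.cond, integral_smul_measure, smul_eq_mul,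
    ENNReal.toReal_inv]
  rfl

omit [IsProbabilityMeasure P] in
lemma setIntegral_study (k : Fin K) (f : Ω → ℝ) :
    ∫ ω in D.H 0 ⁻¹' {k}, f ω ∂P = D.rho P k * ∫ ω, f ω ∂(D.studyMeasure P k) := by
  rw [integral_studyMeasure, mul_inv_cancel_left₀ (hD.rho_pos k).ne']

lemma studyMeasure_real_arm (q : Fin K × Bool) :
    (D.studyMeasure P q.1).real (D.W 0 ⁻¹' {q.2}) = D.armProb P q := by
  have := hD.isProbabilityMeasure_studyMeasure q.1
  obtain ⟨k, w⟩ := q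
  cases w
  · have h : D.W 0 ⁻¹' {false} = (D.W 0 ⁻¹' {true})ᶜ := by ext ω; simp
    simp only [armProb, h]
    rw [probReal_compl_eq_one_sub (hD.measurable_W 0 (measurableSet_singleton true))]
    simp [treatProb]
  · simp [armProb, treatProb]

/-- Randomisation: given the study, the potential outcomes are independent of the arm. -/
lemma integral_cell_indicator (q : Fin K × Bool) {f : (Fin d → ℝ) × ℝ × ℝ → ℝ}
    (hf : Measurable f) :
    ∫ ω, (if (D.H 0 ω, D.W 0 ω) = q then f (D.potential ω) else 0) ∂P =
      D.armProb P q * ∫ ω in D.H 0 ⁻¹' {q.1}, f (D.potential ω) ∂P := by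
  have hW : MeasurableSet (D.W 0 ⁻¹' {q.2}) :=
    hD.measurable_W 0 (measurableSet_singleton q.2)
  have h1 := (hD.randomized q.1).comp (φ := fun w => if w = q.2 then (1 : ℝ) else 0) (ψ := f)
    (measurable_of_finite _) hf
  have h2 := h1.integral_fun_mul_eq_mul_integral
    (((measurable_of_finite fun w => if w = q.2 then (1 : ℝ) else 0).comp
      (hD.measurable_W 0)).aestronglyMeasurable)
    (hf.comp hD.measurable_potential).aestronglyMeasurable
  have h3 : ∫ ω, ((fun w => if w = q.2 then (1 : ℝ) else 0) ∘ D.W 0) ω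
      ∂(D.studyMeasure P q.1) = D.armProb P q := by
    rw [← hD.studyMeasure_real_arm q, ← integral_indicator_one hW]
    refine integral_congr_ae (Eventually.of_forall fun ω => ?_)
    simp [Set.indicator]
  rw [h3] at h2
  simp only [integral_studyMeasure] at h2
  have hρ := (hD.rho_pos q.1).ne'
  have h4 : ∫ ω in D.H 0 ⁻¹' {q.1}, ((fun w => if w = q.2 then (1 : ℝ) else 0) ∘ D.W 0) ω *
      (f ∘ fun ω => (D.X 0 ω, D.Y false 0 ω, D.Y true 0 ω)) ω ∂P =
      D.armProb P q * ∫ ω in D.H 0 ⁻¹' {q.1}, f (D.potential ω) ∂P := by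
    have := congrArg (fun x => D.rho P q.1 * x) h2
    simp only [mul_inv_cancel_left₀ hρ] at this
    rw [this, mul_left_comm, mul_inv_cancel_left₀ hρ]
    rfl
  rw [← h4, ← integral_indicator (hD.measurableSet_study q.1)]
  congr 1
  ext ω
  by_cases hk : D.H 0 ω = q.1 <;> by_cases hw : D.W 0 ω = q.2 <;>
    simp [Set.indicator, hk, hw, Prod.ext_iff, potential]

/-- There are finitely many cells, and in each one randomisation replaces the treatment by the
factor `armProb`. All population moments below are computed this way. -/
lemma integral_cell_fun {r : Fin K × Bool → (Fin d → ℝ) × ℝ × ℝ → ℝ}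
    (hr : ∀ q, Measurable (r q)) (hint : ∀ q, Integrable (fun ω => r q (D.potential ω)) P) :
    Integrable (fun ω => r (D.H 0 ω, D.W 0 ω) (D.potential ω)) P ∧
    ∫ ω, r (D.H 0 ω, D.W 0 ω) (D.potential ω) ∂P =
      ∑ q, D.armProb P q * ∫ ω in D.H 0 ⁻¹' {q.1}, r q (D.potential ω) ∂P := by
  have h : ∀ ω, r (D.H 0 ω, D.W 0 ω) (D.potential ω) =
      ∑ q, if (D.H 0 ω, D.W 0 ω) = q then r q (D.potential ω) else 0 := by
    intro ω; simp
  have hi : ∀ q, Integrable (fun ω => if (D.H 0 ω, D.W 0 ω) = q then r q (D.potential ω) else 0)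
      P := by
    intro q
    refine ((hint q).indicator (s := (fun ω => (D.H 0 ω, D.W 0 ω)) ⁻¹' {q})
      (((hD.measurable_H 0).prodMk (hD.measurable_W 0)) (measurableSet_singleton q))).congr ?_
    refine Eventually.of_forall fun ω => ?_
    simp [Set.indicator]
  simp only [h]
  refine ⟨integrable_finsetSum _ fun q _ => hi q, ?_⟩
  rw [integral_finsetSum _ fun q _ => hi q]
  exact Finset.sum_congr rfl fun q _ => hD.integral_cell_indicator q (hr q)

omit [IsProbabilityMeasure P] in
lemma comap_covariates_le : MeasurableSpace.comap (fun ω => (D.X 0 ω, D.H 0 ω)) inferInstance ≤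
    (inferInstance : MeasurableSpace Ω) :=
  ((hD.measurable_X 0).prodMk (hD.measurable_H 0)).comap_le

lemma setIntegral_noise (w : Bool) (k : Fin K) {B : Set (Fin d → ℝ)} (hB : MeasurableSet B) :
    ∫ ω in D.X 0 ⁻¹' B ∩ D.H 0 ⁻¹' {k}, potentialNoise c β w (D.potential ω) ∂P = 0 := by
  have hS : MeasurableSet[MeasurableSpace.comap (fun ω => (D.X 0 ω, D.H 0 ω)) inferInstance]
      (D.X 0 ⁻¹' B ∩ D.H 0 ⁻¹' {k}) :=
    ⟨B ×ˢ {k}, hB.prod (measurableSet_singleton k), rfl⟩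
  have h := setIntegral_condExp hD.comap_covariates_le
    ((hD.memLp_noise w).integrable (by norm_num)) hS
  simp only [← noise_eq]
  rw [← h, integral_congr_ae (ae_restrict_of_ae (hD.noise_mean w))]
  simp

lemma setIntegral_noise_sq (w : Bool) (k : Fin K) {B : Set (Fin d → ℝ)} (hB : MeasurableSet B) :
    ∫ ω in D.X 0 ⁻¹' B ∩ D.H 0 ⁻¹' {k}, potentialNoise c β w (D.potential ω) ^ 2 ∂P =
      ∫ _ω in D.X 0 ⁻¹' B ∩ D.H 0 ⁻¹' {k}, σ ^ 2 ∂P := by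
  have hS : MeasurableSet[MeasurableSpace.comap (fun ω => (D.X 0 ω, D.H 0 ω)) inferInstance]
      (D.X 0 ⁻¹' B ∩ D.H 0 ⁻¹' {k}) :=
    ⟨B ×ˢ {k}, hB.prod (measurableSet_singleton k), rfl⟩
  have h := setIntegral_condExp hD.comap_covariates_le (hD.memLp_noise w).integrable_sq hS
  simp only [← noise_eq]
  rw [← h, integral_congr_ae (ae_restrict_of_ae (hD.noise_var w))]

/-- Once the cell is fixed, an event about `(H, W, X)` is an event about `X`. This transfers the
noise assumptions, made given `(X, H)`, to conditioning on `(X, W, H)`. -/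
lemma setIntegral_features {r : Fin K × Bool → (Fin d → ℝ) × ℝ × ℝ → ℝ}
    (hr : ∀ q, Measurable (r q)) (hint : ∀ q, Integrable (fun ω => r q (D.potential ω)) P)
    {B : Set (Fin K × Bool × (Fin d → ℝ))} (hB : MeasurableSet B) :
    ∫ ω in (fun ω => features (D.obs 0 ω)) ⁻¹' B, r (D.H 0 ω, D.W 0 ω) (D.potential ω) ∂P =
      ∑ q : Fin K × Bool, D.armProb P q *
        ∫ ω in D.X 0 ⁻¹' ((fun x => (q.1, q.2, x)) ⁻¹' B) ∩ D.H 0 ⁻¹' {q.1},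
          r q (D.potential ω) ∂P := by
  classical
  have hBq : ∀ q : Fin K × Bool,
      MeasurableSet ((fun x : Fin d → ℝ => (q.1, q.2, x)) ⁻¹' B) := fun q =>
    (by fun_prop : Measurable fun x : Fin d → ℝ => (q.1, q.2, x)) hB
  have hBX : ∀ q : Fin K × Bool, MeasurableSet
      (D.X 0 ⁻¹' ((fun x : Fin d → ℝ => (q.1, q.2, x)) ⁻¹' B)) := fun q =>
    hD.measurable_X 0 (hBq q)
  have h := (hD.integral_cell_fun
    (r := fun q y => ((Prod.fst : (Fin d → ℝ) × ℝ × ℝ → _) ⁻¹'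
      ((fun x => (q.1, q.2, x)) ⁻¹' B)).indicator (r q) y)
    (fun q => (hr q).indicator (measurable_fst (hBq q)))
    (fun q => (hint q).indicator (hBX q))).2
  have hset : MeasurableSet ((fun ω => features (D.obs 0 ω)) ⁻¹' B) :=
    (measurable_features.comp (hD.measurable_obs 0)) hB
  rw [← integral_indicator hset]
  refine Eq.trans ?_ (h.trans ?_)
  · rfl
  · refine Finset.sum_congr rfl fun q _ => ?_
    congr 1
    rw [Set.inter_comm, ← setIntegral_indicator (hBX q)]
    rfl

lemma integrable_noise (w : Bool) : Integrable (fun ω => potentialNoise c β w (D.potential ω)) P := by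
  simpa only [← noise_eq] using (hD.memLp_noise w).integrable (by norm_num)

omit [IsProbabilityMeasure P] in
lemma integrable_noise_sq (w : Bool) :
    Integrable (fun ω => potentialNoise c β w (D.potential ω) ^ 2) P := by
  simpa only [← noise_eq] using (hD.memLp_noise w).integrable_sq

lemma setIntegral_resid {B : Set (Fin K × Bool × (Fin d → ℝ))} (hB : MeasurableSet B) :
    ∫ ω in (fun ω => features (D.obs 0 ω)) ⁻¹' B, resid c β (D.obs 0 ω) ∂P = 0 := by
  refine (hD.setIntegral_features (r := fun q => potentialNoise c β q.2)
    (fun q => measurable_potentialNoise c β q.2) (fun q => hD.integrable_noise q.2) hB).trans ?_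
  refine Finset.sum_eq_zero fun q _ => ?_
  rw [hD.setIntegral_noise, mul_zero]
  exact (by fun_prop : Measurable fun x : Fin d → ℝ => (q.1, q.2, x)) hB

lemma setIntegral_resid_sq {B : Set (Fin K × Bool × (Fin d → ℝ))} (hB : MeasurableSet B) :
    ∫ ω in (fun ω => features (D.obs 0 ω)) ⁻¹' B, resid c β (D.obs 0 ω) ^ 2 ∂P =
      σ ^ 2 * P.real ((fun ω => features (D.obs 0 ω)) ⁻¹' B) := by
  have h1 := hD.setIntegral_features (r := fun q y => potentialNoise c β q.2 y ^ 2)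
    (fun q => (measurable_potentialNoise c β q.2).pow_const 2)
    (fun q => hD.integrable_noise_sq q.2) hB
  -- The same decomposition of the constant `σ²` gives `σ² P(B)`, to be matched cell by cell.
  have h2 := hD.setIntegral_features (r := fun _ _ => σ ^ 2) (fun q => measurable_const)
    (fun q => integrable_const _) hB
  rw [setIntegral_const, smul_eq_mul, mul_comm] at h2
  rw [h2]
  refine Eq.trans h1 (Finset.sum_congr rfl fun q _ => ?_)
  rw [hD.setIntegral_noise_sq]
  exact (by fun_prop : Measurable fun x : Fin d → ℝ => (q.1, q.2, x)) hB

lemma integrable_resid_sq : Integrable (fun ω => resid c β (D.obs 0 ω) ^ 2) P :=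
  (hD.integral_cell_fun (r := fun q y => potentialNoise c β q.2 y ^ 2)
    (fun q => (measurable_potentialNoise c β q.2).pow_const 2)
    (fun q => hD.integrable_noise_sq q.2)).1

omit [IsProbabilityMeasure P] in
lemma measurable_resid_obs (i : ℕ) : Measurable fun ω => resid c β (D.obs i ω) :=
  (measurable_resid c β).comp (hD.measurable_obs i)

lemma memLp_resid : MemLp (fun ω => resid c β (D.obs 0 ω)) 2 P :=
  (memLp_two_iff_integrable_sq (hD.measurable_resid_obs 0).aestronglyMeasurable).2
    hD.integrable_resid_sq

lemma integral_mul_resid {u : Fin K × Bool × (Fin d → ℝ) → ℝ} (hu : Measurable u)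
    (hint : Integrable (fun ω => u (features (D.obs 0 ω)) * resid c β (D.obs 0 ω)) P) :
    ∫ ω, u (features (D.obs 0 ω)) * resid c β (D.obs 0 ω) ∂P = 0 := by
  have hF : Measurable fun ω => features (D.obs 0 ω) :=
    measurable_features.comp (hD.measurable_obs 0)
  have hr := hD.memLp_resid.integrable (by norm_num)
  have h0 : (fun _ => (0 : ℝ)) =ᵐ[P] P[fun ω => resid c β (D.obs 0 ω) |
      MeasurableSpace.comap (fun ω => features (D.obs 0 ω)) inferInstance] := by
    refine ae_eq_condExp_of_forall_setIntegral_eq hF.comap_le hr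
      (fun s _ _ => integrableOn_const) ?_ aestronglyMeasurable_const
    rintro s ⟨B, hB, rfl⟩ _
    rw [hD.setIntegral_resid hB]
    simp
  have h1 := condExp_mul_of_stronglyMeasurable_left
    (m := MeasurableSpace.comap (fun ω => features (D.obs 0 ω)) inferInstance) (μ := P)
    (f := fun ω => u (features (D.obs 0 ω))) (g := fun ω => resid c β (D.obs 0 ω))
    (hu.comp (comap_measurable _)).stronglyMeasurable hint hr
  rw [← integral_condExp hF.comap_le]
  refine integral_eq_zero_of_ae (h1.trans ?_)
  filter_upwards [h0] with ω hω
  simp [← hω]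

/-- This is `E(ε² | features) = σ²` written as an identity of measures. In this form it yields the
integrability of `u ε²` from that of `u`, which matters because `X` and `ε` have only second moments
and `(X' ⬝ b)² ε²` is needed. -/
lemma map_features_withDensity :
    (P.withDensity fun ω => ENNReal.ofReal (resid c β (D.obs 0 ω) ^ 2)).map
      (fun ω => features (D.obs 0 ω)) =
    ENNReal.ofReal (σ ^ 2) • P.map fun ω => features (D.obs 0 ω) := by
  have hF : Measurable fun ω => features (D.obs 0 ω) :=
    measurable_features.comp (hD.measurable_obs 0)
  ext B hB
  rw [Measure.map_apply hF hB, withDensity_apply _ (hF hB), Measure.smul_apply,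
    Measure.map_apply hF hB, ← ofReal_integral_eq_lintegral_ofReal
      hD.integrable_resid_sq.integrableOn (Eventually.of_forall fun _ => sq_nonneg _),
    hD.setIntegral_resid_sq hB, ENNReal.ofReal_mul (sq_nonneg σ)]
  simp

lemma integral_mul_resid_sq {u : Fin K × Bool × (Fin d → ℝ) → ℝ} (hu : Measurable u)
    (hint : Integrable (fun ω => u (features (D.obs 0 ω))) P) :
    Integrable (fun ω => u (features (D.obs 0 ω)) * resid c β (D.obs 0 ω) ^ 2) P ∧
    ∫ ω, u (features (D.obs 0 ω)) * resid c β (D.obs 0 ω) ^ 2 ∂P =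
      σ ^ 2 * ∫ ω, u (features (D.obs 0 ω)) ∂P := by
  have hF : Measurable fun ω => features (D.obs 0 ω) :=
    measurable_features.comp (hD.measurable_obs 0)
  have hm : Measurable fun ω => ENNReal.ofReal (resid c β (D.obs 0 ω) ^ 2) :=
    ((hD.measurable_resid_obs 0).pow_const 2).ennreal_ofReal
  have hlt : ∀ᵐ ω ∂P, ENNReal.ofReal (resid c β (D.obs 0 ω) ^ 2) < ⊤ :=
    Eventually.of_forall fun _ => ENNReal.ofReal_lt_top
  have hmap := hD.map_features_withDensity
  have hI : Integrable u ((P.withDensity fun ω =>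
      ENNReal.ofReal (resid c β (D.obs 0 ω) ^ 2)).map fun ω => features (D.obs 0 ω)) := by
    rw [hmap]
    exact ((integrable_map_measure hu.aestronglyMeasurable hF.aemeasurable).2 hint).smul_measure
      ENNReal.ofReal_ne_top
  constructor
  · have := (integrable_map_measure hu.aestronglyMeasurable hF.aemeasurable).1 hI
    rw [integrable_withDensity_iff hm hlt] at this
    simpa [ENNReal.toReal_ofReal (sq_nonneg _)] using this
  · have h1 := integral_map (μ := P.withDensity fun ω =>
      ENNReal.ofReal (resid c β (D.obs 0 ω) ^ 2)) hF.aemeasurable hu.aestronglyMeasurable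
    rw [hmap, integral_smul_measure, integral_map hF.aemeasurable hu.aestronglyMeasurable,
      integral_withDensity_eq_integral_toReal_smul hm hlt] at h1
    simp only [ENNReal.toReal_ofReal (sq_nonneg _), smul_eq_mul] at h1
    rw [h1]
    simp only [mul_comm]

end

end IsCovariateShiftModel

end Units

/-! ### The influence function and the moments of the design. -/

namespace Obs

/-- Summand of the influence function of the regression estimators, `t` being the centring of the
effect and `b` the limits of the weights of the residuals. -/
def influence (c : Bool → ℝ) (β : Bool → Fin d → ℝ) (t : Fin K → ℝ)
    (b : Fin K × Bool → Fin (d + 1) → ℝ) (z : Obs d K) : ℝ :=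
  (effect c β z - t (cell z).1) + (design z ⬝ᵥ b (cell z)) * resid c β z

lemma measurable_design_dot_cell (b : Fin K × Bool → Fin (d + 1) → ℝ) :
    Measurable fun z : Obs d K => design z ⬝ᵥ b (cell z) :=
  measurable_design_dot fun a => measurable_cell_fun fun q => b q a

lemma measurable_influence (c : Bool → ℝ) (β : Bool → Fin d → ℝ) (t : Fin K → ℝ)
    (b : Fin K × Bool → Fin (d + 1) → ℝ) : Measurable (influence c β t b) :=
  ((measurable_effect c β).sub (measurable_cell_fun fun q => t q.1)).add
    ((measurable_design_dot_cell b).mul (measurable_resid c β))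

lemma measurable_aug_dotProduct (v : Fin (d + 1) → ℝ) :
    Measurable fun x : Fin d → ℝ => aug x ⬝ᵥ v := by
  unfold dotProduct
  exact Finset.measurable_sum _ fun a _ => (measurable_aug a).mul_const _

lemma measurable_feature_dot (b : Fin K × Bool → Fin (d + 1) → ℝ) :
    Measurable fun y : Fin K × Bool × (Fin d → ℝ) => aug y.2.2 ⬝ᵥ b (y.1, y.2.1) := by
  unfold dotProduct
  refine Finset.measurable_sum _ fun a _ => ((measurable_aug a).comp (by fun_prop)).mul ?_
  exact (measurable_of_finite fun q : Fin K × Bool => b q a).comp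
    (by fun_prop : Measurable fun y : Fin K × Bool × (Fin d → ℝ) => (y.1, y.2.1))

end Obs

namespace Units

variable (D : Units Ω d K) [MeasurableSpace Ω] (P : Measure Ω)

/-- `E(X' X'ᵀ 1_A)`. -/
noncomputable def moment (A : Finset (Fin K × Bool)) : Matrix (Fin (d + 1)) (Fin (d + 1)) ℝ :=
  Matrix.of fun a b =>
    ∫ ω, ind A (D.obs 0 ω) * (design (D.obs 0 ω) a * design (D.obs 0 ω) b) ∂P

/-- `E(X' 1_A)`. -/
noncomputable def designMean (A : Finset (Fin K × Bool)) : Fin (d + 1) → ℝ :=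
  fun a => ∫ ω, ind A (D.obs 0 ω) * design (D.obs 0 ω) a ∂P

variable {D P} {c : Bool → ℝ} {β : Bool → Fin d → ℝ} {σ : ℝ}

namespace IsCovariateShiftModel

variable [IsProbabilityMeasure P] (hD : D.IsCovariateShiftModel P c β σ)
include hD

omit [IsProbabilityMeasure P] in
lemma memLp_X_apply (j : Fin d) : MemLp (fun ω => D.X 0 ω j) 2 P :=
  hD.memLp_X.of_le ((measurable_pi_apply j).comp (hD.measurable_X 0)).aestronglyMeasurable
    (Eventually.of_forall fun ω => norm_le_pi_norm (D.X 0 ω) j)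

lemma memLp_design (a : Fin (d + 1)) : MemLp (fun ω => design (D.obs 0 ω) a) 2 P := by
  refine Fin.cases ?_ (fun j => ?_) a
  · simpa [design, aug] using memLp_const (1 : ℝ)
  · simpa [design, aug, obs] using hD.memLp_X_apply j

omit [IsProbabilityMeasure P] in
lemma memLp_cell_mul {f : Ω → ℝ} (hf : MemLp f 2 P) (g : Fin K × Bool → ℝ) :
    MemLp (fun ω => f ω * g (cell (D.obs 0 ω))) 2 P := by
  refine hf.of_le_mul (c := ∑ q, |g q|) (hf.aestronglyMeasurable.mul
    ((measurable_cell_fun g).comp (hD.measurable_obs 0)).aestronglyMeasurable)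
    (Eventually.of_forall fun ω => ?_)
  rw [norm_mul, mul_comm]
  refine mul_le_mul_of_nonneg_right ?_ (norm_nonneg _)
  exact Finset.single_le_sum (f := fun q => |g q|) (fun q _ => abs_nonneg _) (mem_univ _)

lemma memLp_design_dot_cell (b : Fin K × Bool → Fin (d + 1) → ℝ) :
    MemLp (fun ω => design (D.obs 0 ω) ⬝ᵥ b (cell (D.obs 0 ω))) 2 P := by
  simp only [dotProduct]
  exact memLp_finsetSum _ fun a _ => hD.memLp_cell_mul (hD.memLp_design a) fun q => b q a

lemma memLp_effect : MemLp (fun ω => effect c β (D.obs 0 ω)) 2 P :=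
  hD.memLp_design_dot_cell fun _ => theta c β true - theta c β false

lemma memLp_cell (g : Fin K × Bool → ℝ) : MemLp (fun ω => g (cell (D.obs 0 ω))) 2 P := by
  simpa using hD.memLp_cell_mul (memLp_const (1 : ℝ)) g

lemma integral_design_mul_resid_sq (b : Fin K × Bool → Fin (d + 1) → ℝ) :
    Integrable (fun ω => ((design (D.obs 0 ω) ⬝ᵥ b (cell (D.obs 0 ω))) *
      resid c β (D.obs 0 ω)) ^ 2) P ∧
    ∫ ω, ((design (D.obs 0 ω) ⬝ᵥ b (cell (D.obs 0 ω))) * resid c β (D.obs 0 ω)) ^ 2 ∂P =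
      σ ^ 2 * ∫ ω, (design (D.obs 0 ω) ⬝ᵥ b (cell (D.obs 0 ω))) ^ 2 ∂P := by
  simp only [mul_pow]
  exact hD.integral_mul_resid_sq ((measurable_feature_dot b).pow_const 2)
    (hD.memLp_design_dot_cell b).integrable_sq

lemma memLp_design_mul_resid (b : Fin K × Bool → Fin (d + 1) → ℝ) :
    MemLp (fun ω => (design (D.obs 0 ω) ⬝ᵥ b (cell (D.obs 0 ω))) * resid c β (D.obs 0 ω)) 2 P :=
  (memLp_two_iff_integrable_sq ((((measurable_design_dot_cell b).comp
    (hD.measurable_obs 0))).mul (hD.measurable_resid_obs 0)).aestronglyMeasurable).2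
    (hD.integral_design_mul_resid_sq b).1

lemma integral_design_mul_resid (b : Fin K × Bool → Fin (d + 1) → ℝ) :
    ∫ ω, (design (D.obs 0 ω) ⬝ᵥ b (cell (D.obs 0 ω))) * resid c β (D.obs 0 ω) ∂P = 0 :=
  hD.integral_mul_resid (measurable_feature_dot b)
    ((hD.memLp_design_mul_resid b).integrable (by norm_num))

lemma ind_mul_design_mul_resid (A : Finset (Fin K × Bool)) (a : Fin (d + 1)) :
    MemLp (fun ω => ind A (D.obs 0 ω) * (design (D.obs 0 ω) a * resid c β (D.obs 0 ω))) 2 P ∧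
    ∫ ω, ind A (D.obs 0 ω) * (design (D.obs 0 ω) a * resid c β (D.obs 0 ω)) ∂P = 0 := by
  classical
  -- A score coordinate is the case of `(X' ⬝ b) ε` in which `b` is a unit vector on `A` and zero
  -- elsewhere.
  obtain ⟨b, hb⟩ : ∃ b : Fin K × Bool → Fin (d + 1) → ℝ,
      b = fun q => if q ∈ A then Pi.single a 1 else 0 := ⟨_, rfl⟩
  have h : ∀ ω, ind A (D.obs 0 ω) * (design (D.obs 0 ω) a * resid c β (D.obs 0 ω)) =
      (design (D.obs 0 ω) ⬝ᵥ b (cell (D.obs 0 ω))) * resid c β (D.obs 0 ω) := by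
    intro ω
    simp only [ind, hb]
    split_ifs <;> simp
  simp only [h]
  exact ⟨hD.memLp_design_mul_resid b, hD.integral_design_mul_resid b⟩

lemma memLp_effect_sub (t : Fin K → ℝ) :
    MemLp (fun ω => effect c β (D.obs 0 ω) - t (cell (D.obs 0 ω)).1) 2 P :=
  hD.memLp_effect.sub (hD.memLp_cell fun q => t q.1)

lemma memLp_influence (t : Fin K → ℝ) (b : Fin K × Bool → Fin (d + 1) → ℝ) :
    MemLp (fun ω => influence c β t b (D.obs 0 ω)) 2 P :=
  (hD.memLp_effect_sub t).add (hD.memLp_design_mul_resid b)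

lemma integral_influence (t : Fin K → ℝ) (b : Fin K × Bool → Fin (d + 1) → ℝ) :
    ∫ ω, influence c β t b (D.obs 0 ω) ∂P =
      ∫ ω, (effect c β (D.obs 0 ω) - t (cell (D.obs 0 ω)).1) ∂P := by
  simp only [influence]
  rw [integral_add ((hD.memLp_effect_sub t).integrable (by norm_num))
    ((hD.memLp_design_mul_resid b).integrable (by norm_num)), hD.integral_design_mul_resid,
    add_zero]

/-- The first part of the influence function depends on the features only, and the residual is
centred given them, so the cross term vanishes; homoscedasticity extracts `σ²` from the square of
the second part. -/
lemma integral_influence_sq (t : Fin K → ℝ) (b : Fin K × Bool → Fin (d + 1) → ℝ) :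
    ∫ ω, influence c β t b (D.obs 0 ω) ^ 2 ∂P =
      ∫ ω, (effect c β (D.obs 0 ω) - t (cell (D.obs 0 ω)).1) ^ 2 ∂P +
        σ ^ 2 * ∫ ω, (design (D.obs 0 ω) ⬝ᵥ b (cell (D.obs 0 ω))) ^ 2 ∂P := by
  have hi : Integrable (fun ω => (effect c β (D.obs 0 ω) - t (cell (D.obs 0 ω)).1) *
      ((design (D.obs 0 ω) ⬝ᵥ b (cell (D.obs 0 ω))) * resid c β (D.obs 0 ω))) P :=
    (hD.memLp_effect_sub t).integrable_mul (hD.memLp_design_mul_resid b)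
  have hcross : ∫ ω, (effect c β (D.obs 0 ω) - t (cell (D.obs 0 ω)).1) *
      ((design (D.obs 0 ω) ⬝ᵥ b (cell (D.obs 0 ω))) * resid c β (D.obs 0 ω)) ∂P = 0 := by
    have h := hD.integral_mul_resid
      (u := fun y => (aug y.2.2 ⬝ᵥ (theta c β true - theta c β false) - t y.1) *
        (aug y.2.2 ⬝ᵥ b (y.1, y.2.1)))
      (((measurable_feature_dot fun _ => theta c β true - theta c β false).sub
        ((measurable_of_finite t).comp measurable_fst)).mul (measurable_feature_dot b))
    simp only [mul_assoc] at h
    exact h hi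
  have hsq : ∀ ω, influence c β t b (D.obs 0 ω) ^ 2 =
      ((effect c β (D.obs 0 ω) - t (cell (D.obs 0 ω)).1) ^ 2 +
      2 * ((effect c β (D.obs 0 ω) - t (cell (D.obs 0 ω)).1) *
        ((design (D.obs 0 ω) ⬝ᵥ b (cell (D.obs 0 ω))) * resid c β (D.obs 0 ω)))) +
      ((design (D.obs 0 ω) ⬝ᵥ b (cell (D.obs 0 ω))) * resid c β (D.obs 0 ω)) ^ 2 := by
    intro ω; simp only [influence]; ring
  have h1 := (hD.memLp_effect_sub t).integrable_sq
  have h2 := (hD.integral_design_mul_resid_sq b).1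
  have h12 : Integrable (fun ω => (effect c β (D.obs 0 ω) - t (cell (D.obs 0 ω)).1) ^ 2 +
      2 * ((effect c β (D.obs 0 ω) - t (cell (D.obs 0 ω)).1) *
        ((design (D.obs 0 ω) ⬝ᵥ b (cell (D.obs 0 ω))) * resid c β (D.obs 0 ω)))) P :=
    h1.add (hi.const_mul 2)
  simp only [hsq]
  rw [integral_add h12 h2, integral_add h1 (hi.const_mul 2),
    integral_const_mul, hcross, (hD.integral_design_mul_resid_sq b).2]
  ring

/-! ### Moments within the studies -/

omit [IsProbabilityMeasure P] in
lemma integral_eq_sum_study {f : Ω → ℝ} (hf : Integrable f P) :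
    ∫ ω, f ω ∂P = ∑ k, ∫ ω in D.H 0 ⁻¹' {k}, f ω ∂P := by
  simp only [← integral_indicator (hD.measurableSet_study _)]
  rw [← integral_finsetSum _ fun k _ => hf.indicator (hD.measurableSet_study k)]
  refine integral_congr_ae (Eventually.of_forall fun ω => ?_)
  simp [Set.indicator]

omit [IsProbabilityMeasure P] in
lemma memLp_studyMeasure {f : Ω → ℝ} (hf : MemLp f 2 P) (k : Fin K) :
    MemLp f 2 (D.studyMeasure P k) := by
  refine (hf.restrict _).smul_measure (ENNReal.inv_ne_top.2 fun h => ?_)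
  have := hD.rho_pos k
  simp [rho, Measure.real, h] at this

lemma variance_design_dot (k : Fin K) (v : Fin (d + 1) → ℝ) :
    Var[fun ω => aug (D.X 0 ω) ⬝ᵥ v; D.studyMeasure P k] =
      (fun j => v j.succ) ⬝ᵥ (D.covStudy P k *ᵥ fun j => v j.succ) := by
  have := hD.isProbabilityMeasure_studyMeasure k
  have hX : ∀ j, MemLp (fun ω => D.X 0 ω j * v j.succ) 2 (D.studyMeasure P k) := fun j =>
    (hD.memLp_studyMeasure (hD.memLp_X_apply j) k).mul_const _
  simp only [aug_dotProduct_cons]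
  rw [variance_const_add (by
    simp only [dotProduct]
    exact (memLp_finsetSum _ fun j _ => hX j).aestronglyMeasurable)]
  simp only [dotProduct]
  rw [variance_fun_sum hX]
  simp only [mulVec, dotProduct, Finset.mul_sum, covariance_mul_const_left,
    covariance_mul_const_right, covStudy, of_apply]
  refine Finset.sum_congr rfl fun i _ => Finset.sum_congr rfl fun j _ => by ring

lemma integral_design_dot_sq_study (k : Fin K) (v : Fin (d + 1) → ℝ) :
    ∫ ω, (aug (D.X 0 ω) ⬝ᵥ v) ^ 2 ∂(D.studyMeasure P k) =
      (fun j => v j.succ) ⬝ᵥ (D.covStudy P k *ᵥ fun j => v j.succ) +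
        (∫ ω, aug (D.X 0 ω) ⬝ᵥ v ∂(D.studyMeasure P k)) ^ 2 := by
  have := hD.isProbabilityMeasure_studyMeasure k
  have hm : MemLp (fun ω => aug (D.X 0 ω) ⬝ᵥ v) 2 (D.studyMeasure P k) :=
    hD.memLp_studyMeasure (hD.memLp_design_dot_cell fun _ => v) k
  rw [← hD.variance_design_dot k v, variance_eq_sub hm]
  simp [Pi.pow_apply]

/-- Second moment is variance plus squared mean. A nonzero slope gives positive variance by
definiteness of `Σ_k`; with zero slope the form is the nonzero constant `v 0`. -/
lemma integral_design_dot_sq_study_pos (k : Fin K) {v : Fin (d + 1) → ℝ} (hv : v ≠ 0) :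
    0 < ∫ ω, (aug (D.X 0 ω) ⬝ᵥ v) ^ 2 ∂(D.studyMeasure P k) := by
  have := hD.isProbabilityMeasure_studyMeasure k
  rw [hD.integral_design_dot_sq_study]
  by_cases h : (fun j : Fin d => v j.succ) = 0
  · have hv0 : v 0 ≠ 0 := by
      intro h0
      apply hv
      ext a
      refine Fin.cases h0 (fun j => congrFun h j) a
    simp only [aug_dotProduct_cons, h]
    simp
    positivity
  · have := (hD.posDef k).dotProduct_mulVec_pos h
    simp only [star_trivial] at this
    positivity

/-! ### The treatment effects -/

lemma integral_noise_study (w : Bool) (k : Fin K) :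
    ∫ ω in D.H 0 ⁻¹' {k}, potentialNoise c β w (D.potential ω) ∂P = 0 := by
  simpa using hD.setIntegral_noise w k MeasurableSet.univ

omit [MeasurableSpace Ω] [IsProbabilityMeasure P] hD in
lemma outcome_sub_eq (ω : Ω) : D.Y true 0 ω - D.Y false 0 ω = effect c β (D.obs 0 ω) +
    (potentialNoise c β true (D.potential ω) - potentialNoise c β false (D.potential ω)) := by
  simp [effect, potentialNoise, potential, design, obs, dotProduct_sub]
  ring

lemma setIntegral_effect_study (k : Fin K) :
    ∫ ω in D.H 0 ⁻¹' {k}, effect c β (D.obs 0 ω) ∂P = D.rho P k * D.tauStudy P k := by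
  rw [tauStudy, ← hD.setIntegral_study]
  simp only [outcome_sub_eq (c := c) (β := β)]
  have hi := fun w => (hD.integrable_noise w).integrableOn (s := D.H 0 ⁻¹' {k})
  have hi' : IntegrableOn (fun ω => potentialNoise c β true (D.potential ω) -
      potentialNoise c β false (D.potential ω)) (D.H 0 ⁻¹' {k}) P := (hi true).sub (hi false)
  rw [integral_add (hD.memLp_effect.integrable (by norm_num)).integrableOn
    hi', integral_sub (hi true) (hi false), hD.integral_noise_study,
    hD.integral_noise_study]
  simp

lemma integrable_effect : Integrable (fun ω => effect c β (D.obs 0 ω)) P :=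
  hD.memLp_effect.integrable (by norm_num)

lemma integral_effect : ∫ ω, effect c β (D.obs 0 ω) ∂P = D.tau P := by
  have h0 : ∀ w, ∫ ω, potentialNoise c β w (D.potential ω) ∂P = 0 := by
    intro w
    rw [hD.integral_eq_sum_study (hD.integrable_noise w)]
    exact Finset.sum_eq_zero fun k _ => hD.integral_noise_study w k
  have hi : Integrable (fun ω => potentialNoise c β true (D.potential ω) -
      potentialNoise c β false (D.potential ω)) P :=
    (hD.integrable_noise true).sub (hD.integrable_noise false)
  rw [tau]
  simp only [outcome_sub_eq (c := c) (β := β)]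
  rw [integral_add hD.integrable_effect hi, integral_sub (hD.integrable_noise true)
    (hD.integrable_noise false), h0, h0]
  simp

omit [IsProbabilityMeasure P] hD in
lemma setIntegral_study_const (k : Fin K) (r : ℝ) :
    ∫ _ω in D.H 0 ⁻¹' {k}, r ∂P = D.rho P k * r := by
  simp [rho, Measure.real]

lemma sum_rho_mul_tauStudy : ∑ k, D.rho P k * D.tauStudy P k = D.tau P := by
  rw [← hD.integral_effect, hD.integral_eq_sum_study hD.integrable_effect]
  exact Finset.sum_congr rfl fun k _ => (hD.setIntegral_effect_study k).symm

lemma integral_tauStudy :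
    ∫ ω, D.tauStudy P (cell (D.obs 0 ω)).1 ∂P = D.tau P := by
  rw [← hD.sum_rho_mul_tauStudy, hD.integral_eq_sum_study
    ((hD.memLp_cell fun q => D.tauStudy P q.1).integrable (by norm_num))]
  refine Finset.sum_congr rfl fun k _ => ?_
  rw [← setIntegral_study_const]
  refine setIntegral_congr_fun (hD.measurableSet_study k) fun ω hω => ?_
  simp only [Set.mem_preimage, Set.mem_singleton_iff] at hω
  simp [cell, obs, hω]

/-- Variance plus squared bias within a study. The constant `r` is free so that both centrings,
`τ_k` and `τ`, are covered. -/
lemma setIntegral_effect_sub_sq (k : Fin K) (r : ℝ) :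
    ∫ ω in D.H 0 ⁻¹' {k}, (effect c β (D.obs 0 ω) - r) ^ 2 ∂P = D.rho P k *
      ((β true - β false) ⬝ᵥ (D.covStudy P k *ᵥ (β true - β false)) +
        (D.tauStudy P k - r) ^ 2) := by
  have := hD.isProbabilityMeasure_studyMeasure k
  -- Subtracting `r` only shifts the intercept, so the centred effect is again linear in `X'`.
  have h : ∀ ω, effect c β (D.obs 0 ω) - r =
      aug (D.X 0 ω) ⬝ᵥ (Fin.cons (c true - c false - r) (β true - β false)) := by
    intro ω
    have hβ : (fun j : Fin d => β true j - β false j) = β true - β false := rfl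
    simp only [effect, design, obs, aug_dotProduct_cons]
    simp only [theta, Pi.sub_apply, Fin.cons_zero, Fin.cons_succ, hβ]
    ring
  have hmean : ∫ ω, (effect c β (D.obs 0 ω) - r) ∂(D.studyMeasure P k) = D.tauStudy P k - r := by
    rw [integral_sub ((hD.memLp_studyMeasure hD.memLp_effect k).integrable (by norm_num))
      (integrable_const _), integral_studyMeasure, hD.setIntegral_effect_study,
      inv_mul_cancel_left₀ (hD.rho_pos k).ne']
    simp
  rw [hD.setIntegral_study, ← hmean]
  simp only [h, hD.integral_design_dot_sq_study, Fin.cons_succ]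

lemma integral_effect_sub_tauStudy_sq :
    ∫ ω, (effect c β (D.obs 0 ω) - D.tauStudy P (cell (D.obs 0 ω)).1) ^ 2 ∂P =
      (β true - β false) ⬝ᵥ ((∑ k, D.rho P k • D.covStudy P k) *ᵥ (β true - β false)) := by
  rw [hD.integral_eq_sum_study (hD.memLp_effect_sub (D.tauStudy P)).integrable_sq, sum_mulVec,
    dotProduct_sum]
  refine Finset.sum_congr rfl fun k _ => ?_
  rw [smul_mulVec, dotProduct_smul, smul_eq_mul]
  have := hD.setIntegral_effect_sub_sq k (D.tauStudy P k)
  rw [sub_self, zero_pow two_ne_zero, add_zero] at this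
  rw [← this]
  refine setIntegral_congr_fun (hD.measurableSet_study k) fun ω hω => ?_
  simp only [Set.mem_preimage, Set.mem_singleton_iff] at hω
  simp [cell, obs, hω]

lemma integral_effect_sub_tau_sq :
    ∫ ω, (effect c β (D.obs 0 ω) - D.tau P) ^ 2 ∂P =
      (β true - β false) ⬝ᵥ ((∑ k, D.rho P k • D.covStudy P k) *ᵥ (β true - β false)) +
        D.betweenVar P := by
  rw [hD.integral_eq_sum_study (hD.memLp_effect_sub fun _ => D.tau P).integrable_sq, sum_mulVec,
    dotProduct_sum, betweenVar, ← Finset.sum_add_distrib]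
  refine Finset.sum_congr rfl fun k _ => ?_
  rw [smul_mulVec, dotProduct_smul, smul_eq_mul, hD.setIntegral_effect_sub_sq, mul_add]

/-! ### Second moments of the design -/

omit [IsProbabilityMeasure P] in
lemma integrable_ind_mul {f : Ω → ℝ} (hf : Integrable f P) (A : Finset (Fin K × Bool)) :
    Integrable (fun ω => ind A (D.obs 0 ω) * f ω) P := by
  refine hf.mono (((measurable_ind A).comp (hD.measurable_obs 0)).aestronglyMeasurable.mul
    hf.aestronglyMeasurable) (Eventually.of_forall fun ω => ?_)
  simp only [ind]
  split_ifs <;> simp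

lemma integrable_design_mul_design (a b : Fin (d + 1)) :
    Integrable (fun ω => design (D.obs 0 ω) a * design (D.obs 0 ω) b) P :=
  (hD.memLp_design a).integrable_mul (hD.memLp_design b)

lemma vecMul_moment (A : Finset (Fin K × Bool)) (v : Fin (d + 1) → ℝ) :
    v ᵥ* D.moment P A = fun b => ∫ ω, ind A (D.obs 0 ω) *
      ((design (D.obs 0 ω) ⬝ᵥ v) * design (D.obs 0 ω) b) ∂P := by
  ext b
  simp only [vecMul, dotProduct, moment, of_apply]
  simp only [← integral_const_mul]
  rw [← integral_finsetSum _ fun a _ =>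
    (hD.integrable_ind_mul (hD.integrable_design_mul_design a b) A).const_mul _]
  refine integral_congr_ae (Eventually.of_forall fun ω => ?_)
  simp only [Finset.mul_sum, Finset.sum_mul]
  exact Finset.sum_congr rfl fun a _ => by ring

lemma vecMul_moment_dotProduct (A : Finset (Fin K × Bool)) (v : Fin (d + 1) → ℝ) :
    (v ᵥ* D.moment P A) ⬝ᵥ v =
      ∫ ω, ind A (D.obs 0 ω) * (design (D.obs 0 ω) ⬝ᵥ v) ^ 2 ∂P := by
  rw [hD.vecMul_moment]
  simp only [dotProduct, ← integral_mul_const]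
  rw [← integral_finsetSum]
  · refine integral_congr_ae (Eventually.of_forall fun ω => ?_)
    simp only [sq]
    rw [Finset.mul_sum, Finset.mul_sum]
    exact Finset.sum_congr rfl fun a _ => by ring
  · intro b _
    refine (hD.integrable_ind_mul ?_ A).mul_const _
    exact (hD.memLp_design_dot_cell fun _ => v).integrable_mul (hD.memLp_design b)

/-- Randomisation for functions of the covariates. -/
lemma integral_cell_design {r : Fin K × Bool → (Fin d → ℝ) → ℝ} (hr : ∀ q, Measurable (r q))
    (hint : ∀ q, Integrable (fun ω => r q (D.X 0 ω)) P) :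
    ∫ ω, r (cell (D.obs 0 ω)) (D.X 0 ω) ∂P =
      ∑ q, D.armProb P q * ∫ ω in D.H 0 ⁻¹' {q.1}, r q (D.X 0 ω) ∂P :=
  (hD.integral_cell_fun (r := fun q y => r q y.1) (fun q => (hr q).comp measurable_fst) hint).2

/-- The quadratic form is a sum over the cells of `A` of probability times `E((X' ⬝ v)² | H = k)`,
and a single cell already makes it positive. -/
lemma moment_posDef {A : Finset (Fin K × Bool)} (hA : A.Nonempty) : (D.moment P A).PosDef := by
  refine PosDef.of_dotProduct_mulVec_pos ?_ fun v hv => ?_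
  · ext a b
    simp only [moment, conjTranspose_apply, of_apply, star_trivial]
    simp only [mul_comm (design (D.obs 0 _) b)]
  · rw [dotProduct_mulVec, star_trivial, hD.vecMul_moment_dotProduct]
    have h := hD.integral_cell_design
      (r := fun q x => if q ∈ A then (aug x ⬝ᵥ v) ^ 2 else 0)
      (fun q => by split_ifs; exacts [(measurable_aug_dotProduct v).pow_const 2, measurable_const])
      (fun q => by
        split_ifs
        · exact (hD.memLp_design_dot_cell fun _ => v).integrable_sq
        · exact integrable_const _)
    have h' : ∫ ω, ind A (D.obs 0 ω) * (design (D.obs 0 ω) ⬝ᵥ v) ^ 2 ∂P =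
        ∫ ω, (if cell (D.obs 0 ω) ∈ A then (aug (D.X 0 ω) ⬝ᵥ v) ^ 2 else 0) ∂P := by
      refine integral_congr_ae (Eventually.of_forall fun ω => ?_)
      simp only [ind]
      split_ifs
      · simp [design, obs]
      · simp
    rw [h', h]
    obtain ⟨q, hq⟩ := hA
    refine Finset.sum_pos' (fun q _ => mul_nonneg (hD.armProb_pos q).le ?_)
      ⟨q, mem_univ q, mul_pos (hD.armProb_pos q) ?_⟩
    · split_ifs
      · exact integral_nonneg fun ω => sq_nonneg _
      · simp
    · simp only [hq, if_true]
      rw [hD.setIntegral_study]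
      exact mul_pos (hD.rho_pos _) (hD.integral_design_dot_sq_study_pos _ hv)

end IsCovariateShiftModel

end Units

/-! ### Strong laws and the limits of the least squares weights. -/

lemma tendsto_matrix_inv {m : Type*} [Fintype m] [DecidableEq m] {A : ℕ → Matrix m m ℝ}
    {M : Matrix m m ℝ} (h : Tendsto A atTop (𝓝 M)) (hM : M.det ≠ 0) :
    Tendsto (fun n => (A n)⁻¹) atTop (𝓝 M⁻¹) := by
  have hdet : Tendsto (fun n => (A n).det) atTop (𝓝 M.det) :=
    (Continuous.matrix_det continuous_id).continuousAt.tendsto.comp h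
  have hadj : Tendsto (fun n => (A n).adjugate) atTop (𝓝 M.adjugate) :=
    (Continuous.matrix_adjugate continuous_id).continuousAt.tendsto.comp h
  simp only [Matrix.inv_def, Ring.inverse_eq_inv']
  exact (hdet.inv₀ hM).smul hadj

namespace Units

variable {D : Units Ω d K} [MeasurableSpace Ω] {P : Measure Ω} {c : Bool → ℝ}
  {β : Bool → Fin d → ℝ} {σ : ℝ}

omit [MeasurableSpace Ω] in
lemma dotProduct_score (n : ℕ) (A : Finset (Fin K × Bool)) (ω : Ω) (b : Fin (d + 1) → ℝ) :
    b ⬝ᵥ D.score c β n A ω = ∑ i ∈ range n,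
      ind A (D.obs i ω) * ((design (D.obs i ω) ⬝ᵥ b) * resid c β (D.obs i ω)) := by
  rw [score, sum_idx, dotProduct_sum]
  refine Finset.sum_congr rfl fun i _ => ?_
  rw [dotProduct_smul, dotProduct_smul, dotProduct_comm, smul_eq_mul, smul_eq_mul,
    mul_comm (resid c β _)]
  rfl

namespace IsCovariateShiftModel

variable [IsProbabilityMeasure P] (hD : D.IsCovariateShiftModel P c β σ)
include hD

omit [IsProbabilityMeasure P] in
lemma strong_law {F : Obs d K → ℝ} (hF : Measurable F)
    (hint : Integrable (fun ω => F (D.obs 0 ω)) P) :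
    ∀ᵐ ω ∂P, Tendsto (fun n : ℕ => (∑ i ∈ range n, F (D.obs i ω)) / n) atTop
      (𝓝 (∫ ω, F (D.obs 0 ω) ∂P)) :=
  strong_law_ae_real (fun i ω => F (D.obs i ω)) hint
    (fun _ _ hij => (hD.iIndepFun_obs.indepFun hij).comp hF hF)
    fun i => (hD.identDistrib_obs i).comp hF

lemma tendsto_designSum (A : Finset (Fin K × Bool)) :
    ∀ᵐ ω ∂P, Tendsto (fun n : ℕ => (n : ℝ)⁻¹ • D.designSum n A ω) atTop
      (𝓝 (D.designMean P A)) := by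
  have h := fun a => hD.strong_law (F := fun z => ind A z * design z a)
    ((measurable_ind A).mul (measurable_design a))
    (hD.integrable_ind_mul ((hD.memLp_design a).integrable (by norm_num)) A)
  filter_upwards [ae_all_iff.2 h] with ω hω
  refine tendsto_pi_nhds.2 fun a => ?_
  simp only [Pi.smul_apply, designSum_apply, smul_eq_mul, inv_mul_eq_div]
  exact hω a

lemma tendsto_gram (A : Finset (Fin K × Bool)) :
    ∀ᵐ ω ∂P, Tendsto (fun n : ℕ => (n : ℝ)⁻¹ • D.gram (D.idx n A ω) ω) atTop
      (𝓝 (D.moment P A)) := by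
  have h := fun a b => hD.strong_law (F := fun z => ind A z * (design z a * design z b))
    ((measurable_ind A).mul ((measurable_design a).mul (measurable_design b)))
    (hD.integrable_ind_mul (hD.integrable_design_mul_design a b) A)
  filter_upwards [ae_all_iff.2 fun a => ae_all_iff.2 (h a)] with ω hω
  refine tendsto_pi_nhds.2 fun a => tendsto_pi_nhds.2 fun b => ?_
  simp only [Matrix.smul_apply, gram_idx_apply, smul_eq_mul, inv_mul_eq_div]
  exact hω a b

lemma moment_det_ne_zero {A : Finset (Fin K × Bool)} (hA : A.Nonempty) :
    (D.moment P A).det ≠ 0 := (hD.moment_posDef hA).det_pos.ne'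

/-- The normalised Gram matrix tends to an invertible one. Hence the exact identities between
estimators hold for all large `n`, almost surely. -/
lemma eventually_gram_det_ne_zero {A : Finset (Fin K × Bool)} (hA : A.Nonempty) :
    ∀ᵐ ω ∂P, ∀ᶠ n : ℕ in atTop, (D.gram (D.idx n A ω) ω).det ≠ 0 := by
  filter_upwards [hD.tendsto_gram A] with ω hω
  have hdet := (Continuous.matrix_det continuous_id).continuousAt.tendsto.comp hω
  filter_upwards [hdet.eventually_ne (hD.moment_det_ne_zero hA)] with n hn h0
  apply hn
  simp [h0]

lemma eventually_armGram_det_ne_zero (hK : Nonempty (Fin K)) :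
    ∀ᵐ ω ∂P, ∀ᶠ n : ℕ in atTop, ∀ w, (D.gram (D.armIdx n w ω) ω).det ≠ 0 := by
  have h := fun w : Bool => hD.eventually_gram_det_ne_zero
    (A := (univ : Finset (Fin K)) ×ˢ {w}) (univ_nonempty.product (singleton_nonempty w))
  filter_upwards [ae_all_iff.2 h] with ω hω
  simp only [eventually_all, armIdx_eq_idx]
  exact hω

lemma eventually_cellGram_det_ne_zero :
    ∀ᵐ ω ∂P, ∀ᶠ n : ℕ in atTop, ∀ k w, (D.gram (D.cellIdx n k w ω) ω).det ≠ 0 := by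
  have h := fun (k : Fin K) (w : Bool) => hD.eventually_gram_det_ne_zero
    (singleton_nonempty (k, w))
  filter_upwards [ae_all_iff.2 fun k => ae_all_iff.2 (h k)] with ω hω
  simp only [eventually_all, cellIdx_eq_idx]
  exact hω

/-- Asymptotic variance of estimators whose error is a combination of least squares errors over
families `A j` of cells, the covariates being averaged over the families `B j`. -/
theorem hasAsympVar_of_ols {J : Type*} [Fintype J] {A B : J → Finset (Fin K × Bool)} {s : J → ℝ}
    {b : J → Fin (d + 1) → ℝ} (hA : ∀ j, (A j).Nonempty)
    (hb : ∀ j, b j ᵥ* D.moment P (A j) = D.designMean P (B j))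
    {v : Fin K × Bool → Fin (d + 1) → ℝ} (hv : ∀ q, v q = ∑ j, if q ∈ A j then s j • b j else 0)
    {t : Fin K → ℝ} (ht : ∫ ω, (effect c β (D.obs 0 ω) - t (cell (D.obs 0 ω)).1) ∂P = 0)
    {T C : ℕ → Ω → ℝ} (hTm : ∀ n, Measurable (T n)) (hCm : ∀ n, Measurable (C n))
    (hC : ∀ ω, ∀ᶠ n : ℕ in atTop, C n ω = (∑ i ∈ range n, t (cell (D.obs i ω)).1) / n)
    (hT : ∀ᵐ ω ∂P, ∀ᶠ n : ℕ in atTop, T n ω = D.sampleEffect c β n ω + ∑ j, s j * ((n : ℝ)⁻¹ *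
      (D.designSum n (B j) ω ⬝ᵥ ((D.gram (D.idx n (A j) ω) ω)⁻¹ *ᵥ D.score c β n (A j) ω)))) :
    HasAsympVar P T C
      (∫ ω, (effect c β (D.obs 0 ω) - t (cell (D.obs 0 ω)).1) ^ 2 ∂P +
        σ ^ 2 * ∫ ω, (design (D.obs 0 ω) ⬝ᵥ v (cell (D.obs 0 ω))) ^ 2 ∂P) := by
  have hm := hD.measurable_obs
  have hφ0 : ∫ ω, influence c β t v (D.obs 0 ω) ∂P = 0 := by rw [hD.integral_influence, ht]
  have hvar : Var[fun ω => influence c β t v (D.obs 0 ω); P] = _ :=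
    (variance_of_integral_eq_zero (hD.memLp_influence t v).aestronglyMeasurable.aemeasurable
      hφ0).trans (hD.integral_influence_sq t v)
  rw [← hvar]
  refine hasAsympVar_of_linear (ι := J × Fin (d + 1)) hm hD.iIndepFun_obs hD.identDistrib_obs
    (measurable_influence c β t v) (hD.memLp_influence t v) hφ0
    (ψ := fun p z => ind (A p.1) z * (design z p.2 * resid c β z))
    (fun p => (measurable_ind _).mul ((measurable_design _).mul (measurable_resid c β)))
    (fun p => (hD.ind_mul_design_mul_resid (A p.1) p.2).1)
    (fun p => (hD.ind_mul_design_mul_resid (A p.1) p.2).2)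
    -- Empirical weight minus its limit. The two factors `n⁻¹` cancel when `n > 0` and the Gram
    -- matrix is invertible; they are there so that the strong law applies to each factor.
    (A := fun n p ω => s p.1 * ((((n : ℝ)⁻¹ • D.designSum n (B p.1) ω) ᵥ*
      ((n : ℝ)⁻¹ • D.gram (D.idx n (A p.1) ω) ω)⁻¹) p.2 - b p.1 p.2)) ?_ ?_ hTm hCm ?_
  · rintro n ⟨j, a⟩
    refine Measurable.const_mul (Measurable.sub_const ?_ _) _
    simp only [vecMul, dotProduct, Pi.smul_apply, smul_eq_mul]
    refine Finset.measurable_sum _ fun i _ =>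
      ((D.measurable_designSum' hm n _ i).const_mul _).mul (measurable_matrix_inv (fun k l => ?_) i a)
    simp only [Matrix.smul_apply]
    exact (D.measurable_gram_idx' hm n _ k l).const_smul ((n : ℝ)⁻¹)
  · rintro ⟨j, a⟩
    filter_upwards [hD.tendsto_gram (A j), hD.tendsto_designSum (B j)] with ω h1 h2
    have hdet := hD.moment_det_ne_zero (hA j)
    have h3 := tendsto_matrix_inv h1 hdet
    have hcont : Continuous fun p : (Fin (d + 1) → ℝ) × Matrix (Fin (d + 1)) (Fin (d + 1)) ℝ =>
        s j * ((p.1 ᵥ* p.2) a - b j a) := by fun_prop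
    have h4 := (hcont.tendsto (D.designMean P (B j), (D.moment P (A j))⁻¹)).comp
      (h2.prodMk_nhds h3)
    rw [← hb j, vecMul_vecMul, mul_nonsing_inv _ (isUnit_iff_ne_zero.2 hdet), vecMul_one, sub_self,
      mul_zero] at h4
    exact h4
  · filter_upwards [hT, ae_all_iff.2 fun j => hD.eventually_gram_det_ne_zero (hA j)] with ω h1 h2
    filter_upwards [h1, eventually_all.2 h2, hC ω, eventually_gt_atTop 0] with n hTn hdet hCn hn
    have hn0 : (n : ℝ) ≠ 0 := by positivity
    have hw : ∀ j, ((n : ℝ)⁻¹ • D.designSum n (B j) ω) ᵥ*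
        ((n : ℝ)⁻¹ • D.gram (D.idx n (A j) ω) ω)⁻¹ =
        D.designSum n (B j) ω ᵥ* (D.gram (D.idx n (A j) ω) ω)⁻¹ := by
      intro j
      rw [inv_smul_of_det_ne_zero (inv_ne_zero hn0) (hdet j), smul_vecMul, vecMul_smul, smul_smul,
        inv_inv, inv_mul_cancel₀ hn0, one_smul]
    have hinf : ∑ i ∈ range n, influence c β t v (D.obs i ω) =
        ∑ i ∈ range n, effect c β (D.obs i ω) - ∑ i ∈ range n, t (cell (D.obs i ω)).1 +
          ∑ j, s j * (b j ⬝ᵥ D.score c β n (A j) ω) := by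
      simp only [influence, Finset.sum_add_distrib, Finset.sum_sub_distrib]
      congr 1
      simp only [dotProduct_score, Finset.mul_sum]
      rw [Finset.sum_comm]
      refine Finset.sum_congr rfl fun i _ => ?_
      rw [hv, dotProduct_sum, Finset.sum_mul]
      refine Finset.sum_congr rfl fun j _ => ?_
      simp only [ind]
      split_ifs
      · rw [dotProduct_smul, smul_eq_mul]; ring
      · simp
    -- The remainder is the actual error term minus the one with limiting weights; the latter is
    -- already part of the influence function.
    have hj : ∀ j, ∑ a, s j * ((D.designSum n (B j) ω ᵥ* (D.gram (D.idx n (A j) ω) ω)⁻¹) a -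
        b j a) * (D.score c β n (A j) ω a / n) =
        s j * ((n : ℝ)⁻¹ * (D.designSum n (B j) ω ⬝ᵥ
          ((D.gram (D.idx n (A j) ω) ω)⁻¹ *ᵥ D.score c β n (A j) ω))) -
          s j * (b j ⬝ᵥ D.score c β n (A j) ω) / n := by
      intro j
      rw [dotProduct_mulVec]
      simp only [dotProduct, Finset.mul_sum, Finset.sum_div]
      rw [← Finset.sum_sub_distrib]
      exact Finset.sum_congr rfl fun a _ => by ring
    rw [hTn, hCn, sampleEffect_eq, hinf, Fintype.sum_prod_type]
    simp only [hw, ← score_apply, hj]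
    rw [Finset.sum_sub_distrib, ← Finset.sum_div]
    ring

/-! ### The limits of the weights -/

omit hD in
lemma ind_product_univ_left (w : Bool) (z : Obs d K) :
    ind ((univ : Finset (Fin K)) ×ˢ {w}) z = if (cell z).2 = w then 1 else 0 := by
  simp only [ind, mem_product, mem_univ, true_and, mem_singleton]

/-- The limits of the weights of the residuals in the pooled estimator. -/
noncomputable def poolWeight (D : Units Ω d K) (P : Measure Ω) (w : Bool) : Fin (d + 1) → ℝ :=
  D.designMean P univ ᵥ* (D.moment P (univ ×ˢ {w}))⁻¹

/-- The limits of the weights of the residuals in the meta-analysis. -/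
noncomputable def metaWeight (D : Units Ω d K) (P : Measure Ω) (q : Fin K × Bool) :
    Fin (d + 1) → ℝ :=
  (D.armProb P q)⁻¹ • Pi.single 0 1

lemma poolWeight_vecMul (hK : Nonempty (Fin K)) (w : Bool) :
    poolWeight D P w ᵥ* D.moment P (univ ×ˢ {w}) = D.designMean P univ := by
  rw [poolWeight, vecMul_vecMul, nonsing_inv_mul _ (isUnit_iff_ne_zero.2
    (hD.moment_det_ne_zero (univ_nonempty.product (singleton_nonempty w)))), vecMul_one]

omit [MeasurableSpace Ω] [IsProbabilityMeasure P] hD in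
lemma design_dot_single (z : Obs d K) (r : ℝ) :
    design z ⬝ᵥ (r • Pi.single 0 1 : Fin (d + 1) → ℝ) = r := by
  simp [design, aug]

/-- The intercept row of the cell moment matrix is `E(X' 1_q)`, which by randomisation is `armProb`
times `E(X' 1_{H = k})`. So the limiting weight involves the intercept only. -/
lemma metaWeight_vecMul (q : Fin K × Bool) :
    metaWeight D P q ᵥ* D.moment P {q} = D.designMean P ({q.1} ×ˢ univ) := by
  rw [hD.vecMul_moment]
  ext a
  simp only [metaWeight, design_dot_single, designMean]
  have hq := (hD.armProb_pos q).ne'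
  have h1 := hD.integral_cell_design
    (r := fun q' x => if q' = q then (D.armProb P q)⁻¹ * aug x a else 0)
    (fun q' => by
      split_ifs
      exacts [(measurable_aug a).const_mul _, measurable_const])
    (fun q' => by
      split_ifs
      · exact ((hD.memLp_design a).integrable (by norm_num)).const_mul _
      · exact integrable_const _)
  rw [Finset.sum_eq_single q (fun q' _ h => by simp [h]) (by simp)] at h1
  simp only [if_true] at h1
  rw [integral_const_mul, mul_inv_cancel_left₀ hq, ← integral_indicator
    (hD.measurableSet_study q.1)] at h1
  have e1 : ∀ ω, ind {q} (D.obs 0 ω) * ((D.armProb P q)⁻¹ * design (D.obs 0 ω) a) =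
      if cell (D.obs 0 ω) = q then (D.armProb P q)⁻¹ * aug (D.X 0 ω) a else 0 := by
    intro ω
    simp only [ind, mem_singleton]
    split_ifs <;> simp [design, obs]
  simp only [e1]
  rw [h1]
  refine integral_congr_ae (Eventually.of_forall fun ω => ?_)
  simp only [Set.indicator, ind, cell, obs, design, mem_product, mem_singleton, mem_univ, and_true,
    Set.mem_preimage, Set.mem_singleton_iff, ite_mul, one_mul, zero_mul]

/-- The second moment of the limiting weights of the meta-analysis. -/
lemma integral_metaWeight_sq :
    ∫ ω, (design (D.obs 0 ω) ⬝ᵥ (armSign (cell (D.obs 0 ω)).2 •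
      metaWeight D P (cell (D.obs 0 ω)))) ^ 2 ∂P =
      ∑ k, D.rho P k / (D.treatProb P k * (1 - D.treatProb P k)) := by
  have h := hD.integral_cell_design
    (r := fun q _ => (armSign q.2 * (D.armProb P q)⁻¹) ^ 2) (fun q => measurable_const)
    (fun q => integrable_const _)
  simp only [metaWeight, smul_smul, design_dot_single]
  rw [h, Fintype.sum_prod_type]
  refine Finset.sum_congr rfl fun k _ => ?_
  have h1 := (hD.treatProb_pos k).ne'
  have h2 := (sub_pos.2 (hD.treatProb_lt_one k)).ne'
  -- The two arms contribute `1/p + 1/(1 - p) = 1/(p (1 - p))`.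
  simp only [setIntegral_study_const, Fintype.sum_bool, armProb, armSign]
  simp
  field_simp
  ring

/-- The pooled weights have the smaller second moment. -/
lemma integral_poolWeight_sq_le (hK : Nonempty (Fin K)) :
    ∫ ω, (design (D.obs 0 ω) ⬝ᵥ (armSign (cell (D.obs 0 ω)).2 •
      poolWeight D P (cell (D.obs 0 ω)).2)) ^ 2 ∂P ≤
      ∑ k, D.rho P k / (D.treatProb P k * (1 - D.treatProb P k)) := by
  rw [← hD.integral_metaWeight_sq]
  set u := fun ω => design (D.obs 0 ω) ⬝ᵥ (armSign (cell (D.obs 0 ω)).2 •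
      poolWeight D P (cell (D.obs 0 ω)).2) with hu
  set v := fun ω => design (D.obs 0 ω) ⬝ᵥ (armSign (cell (D.obs 0 ω)).2 •
      metaWeight D P (cell (D.obs 0 ω))) with hv
  have hu2 : MemLp u 2 P := hD.memLp_design_dot_cell fun q => armSign q.2 • poolWeight D P q.2
  have hv2 : MemLp v 2 P := hD.memLp_design_dot_cell fun q => armSign q.2 • metaWeight D P q
  have hsign : ∀ w, armSign w * armSign w = 1 := by intro w; cases w <;> simp [armSign]
  have hlin : ∀ w, Integrable (fun ω => aug (D.X 0 ω) ⬝ᵥ poolWeight D P w) P := fun w =>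
    (hD.memLp_design_dot_cell fun _ => poolWeight D P w).integrable (by norm_num)
  have hmean : ∀ w, ∫ ω, aug (D.X 0 ω) ⬝ᵥ poolWeight D P w ∂P =
      D.designMean P univ ⬝ᵥ poolWeight D P w := by
    intro w
    simp only [dotProduct, designMean, ← integral_mul_const]
    rw [← integral_finsetSum _ fun a _ => (hD.integrable_ind_mul
      ((hD.memLp_design a).integrable (by norm_num)) _).mul_const _]
    refine integral_congr_ae (Eventually.of_forall fun ω => ?_)
    simp [ind, design, obs]
  -- The factor `1 / armProb` in `v` undoes the selection into the arm, leaving the mean of a linear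
  -- form over the whole population.
  have huv : ∫ ω, u ω * v ω ∂P = ∑ w, D.designMean P univ ⬝ᵥ poolWeight D P w := by
    have h := hD.integral_cell_design
      (r := fun q x => (D.armProb P q)⁻¹ * (aug x ⬝ᵥ poolWeight D P q.2))
      (fun q => (measurable_aug_dotProduct _).const_mul _) (fun q => (hlin q.2).const_mul _)
    have e : ∀ ω, u ω * v ω = (D.armProb P (cell (D.obs 0 ω)))⁻¹ *
        (aug (D.X 0 ω) ⬝ᵥ poolWeight D P (cell (D.obs 0 ω)).2) := by
      intro ω
      simp only [hu, hv, metaWeight, smul_smul, design_dot_single]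
      simp only [dotProduct_smul, smul_eq_mul]
      rw [show design (D.obs 0 ω) = aug (D.X 0 ω) from rfl]
      linear_combination ((D.armProb P (cell (D.obs 0 ω)))⁻¹ *
        (aug (D.X 0 ω) ⬝ᵥ poolWeight D P (cell (D.obs 0 ω)).2)) * hsign (cell (D.obs 0 ω)).2
    simp only [e]
    rw [h, Fintype.sum_prod_type_right]
    refine Finset.sum_congr rfl fun w _ => ?_
    rw [← hmean, hD.integral_eq_sum_study (hlin w)]
    refine Finset.sum_congr rfl fun k _ => ?_
    rw [integral_const_mul, mul_inv_cancel_left₀ (hD.armProb_pos (k, w)).ne']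
  -- The same value, now by the equation `bᵀ E(X'X'ᵀ 1_{W = w}) = E X'` that defines the pooled
  -- weights.
  have huu : ∫ ω, u ω ^ 2 ∂P = ∑ w, D.designMean P univ ⬝ᵥ poolWeight D P w := by
    have e : ∀ ω, u ω ^ 2 = ∑ w, ind ((univ : Finset (Fin K)) ×ˢ {w}) (D.obs 0 ω) *
        (design (D.obs 0 ω) ⬝ᵥ poolWeight D P w) ^ 2 := by
      intro ω
      simp only [hu, ind_product_univ_left, dotProduct_smul, smul_eq_mul, mul_pow, ite_mul,
        one_mul, zero_mul, Finset.sum_ite_eq, mem_univ, if_true]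
      rw [sq (armSign _), hsign, one_mul]
    simp only [e]
    rw [integral_finsetSum _ fun w _ => hD.integrable_ind_mul
      (hD.memLp_design_dot_cell fun _ => poolWeight D P w).integrable_sq _]
    refine Finset.sum_congr rfl fun w _ => ?_
    rw [← hD.vecMul_moment_dotProduct, hD.poolWeight_vecMul hK]
  have hi : Integrable (fun ω => u ω * v ω) P := hu2.integrable_mul hv2
  -- Since `u` is orthogonal to `v - u`, the integral equals `E(v²) - E(u²)`.
  have hnn : 0 ≤ ∫ ω, (v ω ^ 2 - 2 * (u ω * v ω) + u ω ^ 2) ∂P :=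
    integral_nonneg fun ω => by
      have := sq_nonneg (v ω - u ω)
      simp only [Pi.zero_apply]
      nlinarith
  have hi' : Integrable (fun ω => v ω ^ 2 - 2 * (u ω * v ω)) P :=
    hv2.integrable_sq.sub (hi.const_mul 2)
  rw [integral_add hi' hu2.integrable_sq, integral_sub hv2.integrable_sq (hi.const_mul 2),
    integral_const_mul, huv, ← huu] at hnn
  linarith

end IsCovariateShiftModel

end Units

/-! ### Comparison of the estimators, and unbiasedness of Meta-SW. -/

namespace Units

variable {D : Units Ω d K} [MeasurableSpace Ω] {P : Measure Ω} {c : Bool → ℝ}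
  {β : Bool → Fin d → ℝ} {σ : ℝ}

namespace IsCovariateShiftModel

variable [IsProbabilityMeasure P] (hD : D.IsCovariateShiftModel P c β σ)
include hD

/-! ### Asymptotic variances -/

omit hD in
lemma nonempty_studies (D : Units Ω d K) (P : Measure Ω) [IsProbabilityMeasure P] :
    Nonempty (Fin K) :=
  (nonempty_of_isProbabilityMeasure P).map (D.H 0)

/-- Agreement with the pooled estimator is required only eventually and almost surely, so one
variance serves pooling, FedAvg and inverse variance weighting alike. -/
theorem hasAsympVar_of_eventually_eq_tauPool {t : Fin K → ℝ}
    (ht : ∫ ω, (effect c β (D.obs 0 ω) - t (cell (D.obs 0 ω)).1) ∂P = 0)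
    {T C : ℕ → Ω → ℝ} (hTm : ∀ n, Measurable (T n)) (hCm : ∀ n, Measurable (C n))
    (hC : ∀ ω, ∀ᶠ n : ℕ in atTop, C n ω = (∑ i ∈ range n, t (cell (D.obs i ω)).1) / n)
    (hT : ∀ᵐ ω ∂P, ∀ᶠ n : ℕ in atTop, T n ω = D.tauPool n ω) :
    HasAsympVar P T C
      (∫ ω, (effect c β (D.obs 0 ω) - t (cell (D.obs 0 ω)).1) ^ 2 ∂P +
        σ ^ 2 * ∫ ω, (design (D.obs 0 ω) ⬝ᵥ (armSign (cell (D.obs 0 ω)).2 •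
          poolWeight D P (cell (D.obs 0 ω)).2)) ^ 2 ∂P) := by
  have hK := nonempty_studies D P
  refine hD.hasAsympVar_of_ols (J := Bool) 
    (A := fun w => (univ : Finset (Fin K)) ×ˢ ({w} : Finset Bool)) (B := fun _ => univ)
    (s := armSign) (b := poolWeight D P)
    (fun w => univ_nonempty.product (singleton_nonempty w))
    (fun w => hD.poolWeight_vecMul hK w) (v := fun q => armSign q.2 • poolWeight D P q.2)
    (fun q => ?_) ht hTm hCm hC ?_
  · simp only [mem_product, mem_univ, true_and, mem_singleton, Finset.sum_ite_eq, if_true]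
  · filter_upwards [hT, hD.eventually_armGram_det_ne_zero hK] with ω h1 h2
    filter_upwards [h1, h2] with n h3 h4
    rw [h3, D.tauPool_eq c β h4]

theorem hasAsympVar_tauMetaSW {t : Fin K → ℝ}
    (ht : ∫ ω, (effect c β (D.obs 0 ω) - t (cell (D.obs 0 ω)).1) ∂P = 0)
    {C : ℕ → Ω → ℝ} (hCm : ∀ n, Measurable (C n))
    (hC : ∀ ω, ∀ᶠ n : ℕ in atTop, C n ω = (∑ i ∈ range n, t (cell (D.obs i ω)).1) / n) :
    HasAsympVar P D.tauMetaSW C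
      (∫ ω, (effect c β (D.obs 0 ω) - t (cell (D.obs 0 ω)).1) ^ 2 ∂P +
        σ ^ 2 * ∑ k, D.rho P k / (D.treatProb P k * (1 - D.treatProb P k))) := by
  rw [← hD.integral_metaWeight_sq]
  refine hD.hasAsympVar_of_ols (J := Fin K × Bool) (A := fun q => {q})
    (B := fun q => {q.1} ×ˢ univ) (s := fun q => armSign q.2) (b := metaWeight D P)
    (fun q => singleton_nonempty q) (fun q => hD.metaWeight_vecMul q)
    (v := fun q => armSign q.2 • metaWeight D P q)
    (fun q => ?_) ht (D.measurable_tauMetaSW hD.measurable_obs) hCm hC ?_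
  · simp only [mem_singleton, Finset.sum_ite_eq, mem_univ, if_true]
  · filter_upwards [hD.eventually_cellGram_det_ne_zero] with ω h1
    filter_upwards [h1] with n h2
    rw [D.tauMetaSW_eq c β h2]

/-- The asymptotic variances of all estimators, for a centring by study-level values `t`. -/
theorem exists_hasAsympVar {t : Fin K → ℝ}
    (ht : ∫ ω, (effect c β (D.obs 0 ω) - t (cell (D.obs 0 ω)).1) ∂P = 0)
    {C : ℕ → Ω → ℝ} (hCm : ∀ n, Measurable (C n))
    (hC : ∀ ω, ∀ᶠ n : ℕ in atTop, C n ω = (∑ i ∈ range n, t (cell (D.obs i ω)).1) / n)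
    {η : ℕ → Bool → Ω → ℝ} (hη : D.IsLearningRate η) (θ₀ : Bool → Fin (d + 1) → ℝ) {V : ℝ}
    (hV : V = ∫ ω, (effect c β (D.obs 0 ω) - t (cell (D.obs 0 ω)).1) ^ 2 ∂P +
        σ ^ 2 * ∑ k, D.rho P k / (D.treatProb P k * (1 - D.treatProb P k))) :
    ∃ v : ℝ, HasAsympVar P D.tauPool C v ∧ HasAsympVar P (D.tauGD η θ₀) C v ∧
      HasAsympVar P (D.tauIVW σ) C v ∧ HasAsympVar P D.tauMetaSW C V ∧ v ≤ V := by
  have hK := nonempty_studies D P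
  have hm := hD.measurable_obs
  refine ⟨_, hD.hasAsympVar_of_eventually_eq_tauPool ht (D.measurable_tauPool hm) hCm hC
    (Eventually.of_forall fun ω => Eventually.of_forall fun n => rfl),
    hD.hasAsympVar_of_eventually_eq_tauPool ht (D.measurable_tauGD hm hη.1 θ₀) hCm hC ?_,
    hD.hasAsympVar_of_eventually_eq_tauPool ht (D.measurable_tauIVW hm σ) hCm hC ?_,
    hV ▸ hD.hasAsympVar_tauMetaSW ht hCm hC, ?_⟩
  · filter_upwards [hD.eventually_armGram_det_ne_zero hK] with ω h1
    filter_upwards [h1] with n h2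
    exact D.tauGD_eq_tauPool hη θ₀ h2
  · filter_upwards [hD.eventually_armGram_det_ne_zero hK, hD.eventually_cellGram_det_ne_zero]
      with ω h1 h2
    filter_upwards [h1, h2] with n h3 h4
    exact D.tauIVW_eq_tauPool hD.sigma_pos h4 h3
  · rw [hV]
    have := mul_le_mul_of_nonneg_left (hD.integral_poolWeight_sq_le hK) (sq_nonneg σ)
    linarith

/-! ### Unbiasedness -/

omit [IsProbabilityMeasure P] in
lemma designSigma_le (n : ℕ) : D.designSigma n ≤ (inferInstance : MeasurableSpace Ω) :=
  (measurable_pi_lambda _ fun i : Fin n =>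
    (measurable_features.comp (hD.measurable_obs i) :
      Measurable fun ω => features (D.obs i ω))).comap_le

omit [MeasurableSpace Ω] hD in
lemma assignmentSigma_le_designSigma (D : Units Ω d K) (n : ℕ) :
    D.assignmentSigma n ≤ D.designSigma n := by
  have h : Measurable fun (y : Fin n → Fin K × Bool × (Fin d → ℝ)) i => ((y i).1, (y i).2.1) := by
    fun_prop
  have h' : Measurable[D.designSigma n] fun ω (i : Fin n) => (D.H i ω, D.W i ω) :=
    h.comp (comap_measurable fun ω (i : Fin n) => (D.H i ω, D.W i ω, D.X i ω))
  exact h'.comap_le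

lemma integral_mul_resid_designSigma {n i : ℕ} (hi : i < n) {u : Ω → ℝ}
    (hu : Measurable[D.designSigma n] u)
    (hint : Integrable (fun ω => u ω * resid c β (D.obs i ω)) P) :
    ∫ ω, u ω * resid c β (D.obs i ω) ∂P = 0 := by
  have hle := hD.designSigma_le n
  have hr : Integrable (fun ω => resid c β (D.obs i ω)) P :=
    (((hD.identDistrib_obs i).comp (measurable_resid c β)).memLp_iff.2
      hD.memLp_resid).integrable (by norm_num)
  have h0 : (fun _ => (0 : ℝ)) =ᵐ[P] P[fun ω => resid c β (D.obs i ω) | D.designSigma n] := by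
    refine ae_eq_condExp_of_forall_setIntegral_eq hle hr
      (fun s _ _ => integrableOn_const) ?_ aestronglyMeasurable_const
    intro s hs _
    rw [setIntegral_eq_zero_of_iIndepFun hD.measurable_obs hD.iIndepFun_obs hD.identDistrib_obs
      measurable_features (measurable_resid c β) (hD.memLp_resid.integrable (by norm_num))
      (fun B hB => hD.setIntegral_resid hB) hs ⟨i, hi⟩]
    simp
  have h1 := condExp_mul_of_stronglyMeasurable_left (m := D.designSigma n) (μ := P)
    (f := u) (g := fun ω => resid c β (D.obs i ω)) hu.stronglyMeasurable hint hr
  rw [← integral_condExp hle]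
  refine integral_eq_zero_of_ae (h1.trans ?_)
  filter_upwards [h0] with ω hω
  simp [← hω]

/-- Linear combinations of the residuals with weights depending on the design are centred given
the design, as soon as they are integrable. -/
lemma setIntegral_sum_mul_resid {n : ℕ} {a : ℕ → Ω → ℝ}
    (ha : ∀ i < n, Measurable[D.designSigma n] (a i)) {S : Set Ω}
    (hS : MeasurableSet[D.designSigma n] S)
    (hint : IntegrableOn (fun ω => ∑ i ∈ range n, a i ω * resid c β (D.obs i ω)) S P) :
    ∫ ω in S, ∑ i ∈ range n, a i ω * resid c β (D.obs i ω) ∂P = 0 := by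
  have hle := hD.designSigma_le n
  -- Only the whole sum is known to be integrable, not its terms. On these design events, increasing
  -- to `S`, the weights are bounded and the sum may be integrated term by term.
  let U : ℕ → Set Ω := fun m => S ∩ ⋂ i ∈ range n, {ω | |a i ω| ≤ m}
  have hU : ∀ m, MeasurableSet[D.designSigma n] (U m) := by
    intro m
    refine hS.inter (Finset.measurableSet_biInter _ fun i hi => ?_)
    have hai := ha i (mem_range.1 hi)
    have habs : Measurable[D.designSigma n] fun ω => |a i ω| := measurable_norm.comp hai
    exact habs measurableSet_Iic
  have hmono : Monotone U := by
    intro m m' hm ω hω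
    simp only [U, Set.mem_inter_iff, Set.mem_iInter, Set.mem_ofPred_eq] at hω ⊢
    exact ⟨hω.1, fun i hi => (hω.2 i hi).trans (by exact_mod_cast hm)⟩
  have hunion : ⋃ m, U m = S := by
    ext ω
    simp only [U, Set.mem_iUnion, Set.mem_inter_iff, Set.mem_iInter, Set.mem_ofPred_eq]
    refine ⟨fun ⟨_, h, _⟩ => h, fun h => ?_⟩
    obtain ⟨m, hm⟩ := exists_nat_ge (∑ i ∈ range n, |a i ω|)
    exact ⟨m, h, fun i hi =>
      (Finset.single_le_sum (f := fun i => |a i ω|) (fun _ _ => abs_nonneg _) hi).trans hm⟩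
  have hlim := tendsto_setIntegral_of_monotone (fun m => hle _ (hU m)) hmono
    (by rwa [hunion] : IntegrableOn (fun ω => ∑ i ∈ range n, a i ω * resid c β (D.obs i ω))
      (⋃ m, U m) P)
  rw [hunion] at hlim
  refine tendsto_nhds_unique hlim (tendsto_const_nhds.congr fun m => ?_)
  rw [← integral_indicator (hle _ (hU m))]
  have hterm : ∀ i ∈ range n, Integrable (fun ω => (U m).indicator (a i) ω *
      resid c β (D.obs i ω)) P := by
    intro i hi
    have hr : Integrable (fun ω => resid c β (D.obs i ω)) P :=
      (((hD.identDistrib_obs i).comp (measurable_resid c β)).memLp_iff.2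
        hD.memLp_resid).integrable (by norm_num)
    refine hr.bdd_mul (c := (m : ℝ))
      (((ha i (mem_range.1 hi)).mono hle le_rfl).indicator (hle _ (hU m))).aestronglyMeasurable
      (Eventually.of_forall fun ω => ?_)
    by_cases h : ω ∈ U m
    · rw [Set.indicator_of_mem h]
      have := h.2
      simp only [Set.mem_iInter] at this
      exact this i hi
    · rw [Set.indicator_of_notMem h, norm_zero]
      positivity
  have e : ∀ ω, (U m).indicator (fun ω => ∑ i ∈ range n, a i ω * resid c β (D.obs i ω)) ω =
      ∑ i ∈ range n, (U m).indicator (a i) ω * resid c β (D.obs i ω) := by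
    intro ω
    by_cases h : ω ∈ U m <;> simp [h]
  simp only [e]
  rw [integral_finsetSum _ hterm]
  refine (Finset.sum_eq_zero fun i hi => ?_).symm
  have hi' := mem_range.1 hi
  exact hD.integral_mul_resid_designSigma hi' ((ha i hi').indicator (hU m)) (hterm i hi)

lemma integrable_effect_obs (i : ℕ) : Integrable (fun ω => effect c β (D.obs i ω)) P :=
  ((hD.identDistrib_obs i).comp (measurable_effect c β)).integrable_iff.2 hD.integrable_effect

lemma integrable_sampleEffect (n : ℕ) : Integrable (D.sampleEffect c β n) P := by
  have e : D.sampleEffect c β n = fun ω => (∑ i ∈ range n, effect c β (D.obs i ω)) / n :=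
    funext fun ω => D.sampleEffect_eq c β n ω
  rw [e]
  exact (integrable_finsetSum _ fun i _ => hD.integrable_effect_obs i).div_const _

theorem setIntegral_tauMetaSW_eq_sampleEffect {n : ℕ} {S : Set Ω}
    (hS : MeasurableSet[D.designSigma n] S) (hfull : ∀ᵐ ω ∂P, ω ∈ S → D.LocalFullRank n ω)
    (hint : IntegrableOn (D.tauMetaSW n) S P) :
    ∫ ω in S, D.tauMetaSW n ω ∂P = ∫ ω in S, D.sampleEffect c β n ω ∂P := by
  -- The coefficient of the residual of unit `i` in the error formula `tauMetaSW_eq`; it depends on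
  -- the design only.
  let a : ℕ → Ω → ℝ := fun i ω => ∑ q : Fin K × Bool, armSign q.2 * ((n : ℝ)⁻¹ *
    (ind {q} (D.obs i ω) * (design (D.obs i ω) ⬝ᵥ
      (D.designSum n ({q.1} ×ˢ univ) ω ᵥ* (D.gram (D.idx n {q} ω) ω)⁻¹))))
  have hF := fun i (hi : i < n) => D.measurable_features_designSigma hi
  have ha : ∀ i < n, Measurable[D.designSigma n] (a i) := by
    intro i hi
    refine Finset.measurable_sum _ fun q _ => Measurable.const_mul (Measurable.const_mul
      (Measurable.mul ?_ ?_) _) _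
    · have h1 : Measurable fun y : Fin K × Bool × (Fin d → ℝ) =>
          if (y.1, y.2.1) ∈ ({q} : Finset _) then (1 : ℝ) else 0 :=
        (measurable_of_finite fun q' : Fin K × Bool =>
          if q' ∈ ({q} : Finset _) then (1 : ℝ) else 0).comp
          (by fun_prop : Measurable fun y : Fin K × Bool × (Fin d → ℝ) => (y.1, y.2.1))
      exact h1.comp (hF i hi)
    · simp only [dotProduct, vecMul]
      refine Finset.measurable_sum _ fun l _ => Measurable.mul ?_
        (Finset.measurable_sum _ fun k _ => Measurable.mul ?_ ?_)
      · exact ((measurable_aug l).comp (by fun_prop :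
          Measurable fun y : Fin K × Bool × (Fin d → ℝ) => y.2.2)).comp (hF i hi)
      · exact D.measurable_designSum hF _ k
      · exact measurable_matrix_inv (D.measurable_gram_idx hF {q}) k l
  have hdiff : ∀ ω, D.LocalFullRank n ω → D.tauMetaSW n ω - D.sampleEffect c β n ω =
      ∑ i ∈ range n, a i ω * resid c β (D.obs i ω) := by
    intro ω hω
    rw [D.tauMetaSW_eq c β ((D.localFullRank_iff n ω).1 hω), add_sub_cancel_left]
    simp only [dotProduct_mulVec, dotProduct_score, a, Finset.mul_sum, Finset.sum_mul]
    rw [Finset.sum_comm]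
    refine Finset.sum_congr rfl fun i _ => Finset.sum_congr rfl fun q _ => by ring
  have hle := hD.designSigma_le n
  have hae : (fun ω => D.tauMetaSW n ω - D.sampleEffect c β n ω) =ᵐ[P.restrict S]
      fun ω => ∑ i ∈ range n, a i ω * resid c β (D.obs i ω) := by
    rw [EventuallyEq, ae_restrict_iff' (hle _ hS)]
    filter_upwards [hfull] with ω hω hωS using hdiff ω (hω hωS)
  have hse := (hD.integrable_sampleEffect n).integrableOn (s := S)
  have h0 := hD.setIntegral_sum_mul_resid ha hS ((hint.sub hse).congr hae)
  rw [← integral_congr_ae hae, integral_sub hint hse] at h0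
  linarith

/-- By randomisation the arm carries no information on the covariates, so the effect has mean `τ_k`
in either arm of study `k`. -/
lemma setIntegral_cell_effect_sub (B : Set (Fin K × Bool)) :
    ∫ ω in (fun ω => cell (D.obs 0 ω)) ⁻¹' B,
      (effect c β (D.obs 0 ω) - D.tauStudy P (cell (D.obs 0 ω)).1) ∂P = 0 := by
  classical
  have hB : MeasurableSet ((fun ω => cell (D.obs 0 ω)) ⁻¹' B) :=
    (measurable_cell.comp (hD.measurable_obs 0)) B.toFinite.measurableSet
  rw [← integral_indicator hB]
  have h := hD.integral_cell_design
    (r := fun q x => if q ∈ B then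
      aug x ⬝ᵥ (theta c β true - theta c β false) - D.tauStudy P q.1 else 0)
    (fun q => by
      split_ifs
      exacts [(measurable_aug_dotProduct _).sub_const _, measurable_const])
    (fun q => by
      split_ifs
      · exact hD.integrable_effect.sub (integrable_const _)
      · exact integrable_const _)
  refine Eq.trans ?_ (h.trans (Finset.sum_eq_zero fun q _ => ?_))
  · refine integral_congr_ae (Eventually.of_forall fun ω => ?_)
    simp only [Set.indicator, Set.mem_preimage]
    rfl
  · split_ifs
    · change D.armProb P q * ∫ ω in D.H 0 ⁻¹' {q.1},
        (effect c β (D.obs 0 ω) - D.tauStudy P q.1) ∂P = 0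
      rw [integral_sub hD.integrable_effect.integrableOn (integrable_const _),
        setIntegral_study_const, hD.setIntegral_effect_study, sub_self, mul_zero]
    · simp

lemma integrable_tauStudy_obs (i : ℕ) :
    Integrable (fun ω => D.tauStudy P (cell (D.obs i ω)).1) P :=
  ((hD.identDistrib_obs i).comp (measurable_cell_fun fun q => D.tauStudy P q.1)).integrable_iff.2
    ((hD.memLp_cell fun q => D.tauStudy P q.1).integrable (by norm_num))

lemma setIntegral_sampleEffect_eq_tauGivenH {n : ℕ} {S : Set Ω}
    (hS : MeasurableSet[D.assignmentSigma n] S) :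
    ∫ ω in S, D.sampleEffect c β n ω ∂P = ∫ ω in S, D.tauGivenH P n ω ∂P := by
  simp only [sampleEffect_eq, tauGivenH_eq]
  rw [integral_div, integral_div,
    integral_finsetSum _ fun i _ => (hD.integrable_effect_obs i).integrableOn,
    integral_finsetSum _ fun i _ => (hD.integrable_tauStudy_obs i).integrableOn]
  congr 1
  refine Finset.sum_congr rfl fun i hi => ?_
  have h := setIntegral_eq_zero_of_iIndepFun hD.measurable_obs hD.iIndepFun_obs
    hD.identDistrib_obs (f := cell) measurable_cell
    (r := fun z => effect c β z - D.tauStudy P (cell z).1)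
    ((measurable_effect c β).sub (measurable_cell_fun fun q => D.tauStudy P q.1))
    (hD.integrable_effect.sub (hD.integrable_tauStudy_obs 0))
    (fun B _ => hD.setIntegral_cell_effect_sub B) hS ⟨i, mem_range.1 hi⟩
  rw [integral_sub (hD.integrable_effect_obs i).integrableOn
    (hD.integrable_tauStudy_obs i).integrableOn] at h
  exact sub_eq_zero.1 h

theorem setIntegral_tauMetaSW_eq_tauGivenH {n : ℕ} {S : Set Ω}
    (hS : MeasurableSet[D.assignmentSigma n] S) (hfull : ∀ᵐ ω ∂P, ω ∈ S → D.LocalFullRank n ω)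
    (hint : IntegrableOn (D.tauMetaSW n) S P) :
    ∫ ω in S, D.tauMetaSW n ω ∂P = ∫ ω in S, D.tauGivenH P n ω ∂P := by
  rw [hD.setIntegral_tauMetaSW_eq_sampleEffect (assignmentSigma_le_designSigma D n _ hS) hfull hint,
    hD.setIntegral_sampleEffect_eq_tauGivenH hS]

theorem integral_sampleEffect {n : ℕ} (hn : 0 < n) :
    ∫ ω, D.sampleEffect c β n ω ∂P = D.tau P := by
  have hn0 : (n : ℝ) ≠ 0 := by positivity
  simp only [sampleEffect_eq]
  rw [integral_div, integral_finsetSum _ fun i _ => hD.integrable_effect_obs i]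
  have h : ∀ i, ∫ ω, effect c β (D.obs i ω) ∂P = D.tau P := fun i =>
    ((hD.identDistrib_obs i).comp (measurable_effect c β)).integral_eq.trans hD.integral_effect
  simp [h, hn0]

theorem integral_tauGivenH {n : ℕ} (hn : 0 < n) : ∫ ω, D.tauGivenH P n ω ∂P = D.tau P := by
  rw [← hD.integral_sampleEffect hn]
  have := hD.setIntegral_sampleEffect_eq_tauGivenH (n := n) (S := Set.univ) MeasurableSet.univ
  simpa using this.symm

/-- Local full rank holds eventually along almost every path; dominated convergence of the
indicators. -/
lemma tendsto_localFullRank :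
    Tendsto (fun n => P.real {ω | D.LocalFullRank n ω}) atTop (𝓝 1) := by
  have hm : ∀ n, MeasurableSet {ω | D.LocalFullRank n ω} := fun n =>
    D.measurableSet_localFullRank fun i _ => measurable_features.comp (hD.measurable_obs i)
  have h := tendsto_integral_of_dominated_convergence (μ := P)
    (F := fun n => {ω | D.LocalFullRank n ω}.indicator fun _ => (1 : ℝ)) (f := fun _ => 1)
    (fun _ => 1) (fun n => (measurable_const.indicator (hm n)).aestronglyMeasurable)
    (integrable_const _) (fun n => Eventually.of_forall fun ω => ?_) ?_
  · simpa [integral_indicator_const _ (hm _)] using h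
  · simp only [Set.indicator]
    split_ifs <;> simp
  · filter_upwards [hD.eventually_cellGram_det_ne_zero] with ω hω
    refine tendsto_const_nhds.congr' ?_
    filter_upwards [hω] with n hn
    rw [Set.indicator_of_mem]
    exact (D.localFullRank_iff n ω).2 hn

lemma tendsto_integral_abs_sampleEffect_sub :
    Tendsto (fun n => ∫ ω, |D.sampleEffect c β n ω - D.tau P| ∂P) atTop (𝓝 0) := by
  have h := strong_law_Lp (μ := P) (p := 1) le_rfl ENNReal.one_ne_top
    (fun i ω => effect c β (D.obs i ω)) (memLp_one_iff_integrable.2 hD.integrable_effect)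
    (fun _ _ hij => (hD.iIndepFun_obs.indepFun hij).comp (measurable_effect c β)
      (measurable_effect c β)) fun i => (hD.identDistrib_obs i).comp (measurable_effect c β)
  rw [hD.integral_effect] at h
  have h' := (ENNReal.tendsto_toReal ENNReal.zero_ne_top).comp h
  rw [ENNReal.toReal_zero] at h'
  refine h'.congr fun n => ?_
  simp only [Function.comp_apply, eLpNorm_one_eq_lintegral_enorm]
  rw [← integral_norm_eq_lintegral_enorm]
  · refine integral_congr_ae (Eventually.of_forall fun ω => ?_)
    simp only [sampleEffect_eq, Real.norm_eq_abs, smul_eq_mul, div_eq_inv_mul]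
  · exact (((integrable_finsetSum _ fun i _ => hD.integrable_effect_obs i).const_mul _).sub
      (integrable_const _)).aestronglyMeasurable

/-- On local full rank the estimator may be replaced by `sampleEffect` under the integral. The event
depends on the covariates, so conditioning may bias `sampleEffect`, but the L¹ law of large numbers
makes this bias vanish as the probability of the event tends to one. -/
theorem tendsto_integral_tauMetaSW_cond
    (hint : ∀ᶠ n in atTop, IntegrableOn (D.tauMetaSW n) {ω | D.LocalFullRank n ω} P) :
    Tendsto (fun n : ℕ => ∫ ω, D.tauMetaSW n ω ∂P[|{ω | D.LocalFullRank n ω}]) atTop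
      (𝓝 (D.tau P)) := by
  set F : ℕ → Set Ω := fun n => {ω | D.LocalFullRank n ω} with hF
  have hm : ∀ n, MeasurableSet[D.designSigma n] (F n) := fun n =>
    D.measurableSet_localFullRank fun i hi => D.measurable_features_designSigma hi
  have hP := hD.tendsto_localFullRank
  have herr : Tendsto (fun n => ∫ ω in F n, (D.sampleEffect c β n ω - D.tau P) ∂P) atTop
      (𝓝 0) := by
    refine squeeze_zero_norm (fun n => ?_) hD.tendsto_integral_abs_sampleEffect_sub
    have hi : Integrable (fun ω => |D.sampleEffect c β n ω - D.tau P|) P :=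
      ((hD.integrable_sampleEffect n).sub (integrable_const _)).abs
    exact (norm_integral_le_integral_norm _).trans
      (setIntegral_le_integral hi (Eventually.of_forall fun _ => abs_nonneg _))
  have hlim : Tendsto (fun n => D.tau P + (P.real (F n))⁻¹ *
      ∫ ω in F n, (D.sampleEffect c β n ω - D.tau P) ∂P) atTop (𝓝 (D.tau P)) := by
    have := ((hP.inv₀ one_ne_zero).mul herr).const_add (D.tau P)
    simpa using this
  refine hlim.congr' ?_
  filter_upwards [hint, hP.eventually_ne one_ne_zero] with n hn hn0
  rw [ProbabilityTheory.cond, integral_smul_measure, ENNReal.toReal_inv, smul_eq_mul,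
    hD.setIntegral_tauMetaSW_eq_sampleEffect (hm n) (Eventually.of_forall fun ω h => h) hn,
    integral_sub (hD.integrable_sampleEffect n).integrableOn (integrable_const _),
    setIntegral_const, smul_eq_mul, mul_sub, inv_mul_cancel_left₀ hn0]
  simp [Measure.real, hF]

end IsCovariateShiftModel

end Units

end FedRCT

theorem mainTheorem6 {Ω : Type*} [MeasurableSpace Ω] (P : Measure Ω) [IsProbabilityMeasure P]
    {d K : ℕ} (D : FedRCT.Units Ω d K) (c : Bool → ℝ) (β : Bool → Fin d → ℝ) (σ : ℝ)
    (hD : D.IsCovariateShiftModel P c β σ)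
    (η : ℕ → Bool → Ω → ℝ) (hη : D.IsLearningRate η) (θ₀ : Bool → Fin (d + 1) → ℝ) :
    -- comparison of the asymptotic variances
    (∃ v : ℝ,
      FedRCT.HasAsympVar P D.tauPool (fun _ _ => D.tau P) v ∧
      FedRCT.HasAsympVar P (D.tauGD η θ₀) (fun _ _ => D.tau P) v ∧
      FedRCT.HasAsympVar P (D.tauIVW σ) (fun _ _ => D.tau P) v ∧
      FedRCT.HasAsympVar P D.tauMetaSW (fun _ _ => D.tau P)
        (D.metaVar P β σ + D.betweenVar P) ∧
      v ≤ D.metaVar P β σ + D.betweenVar P) ∧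
    -- the same comparison, the variability of the memberships being removed
    (∃ v : ℝ,
      FedRCT.HasAsympVar P D.tauPool (D.tauGivenH P) v ∧
      FedRCT.HasAsympVar P (D.tauGD η θ₀) (D.tauGivenH P) v ∧
      FedRCT.HasAsympVar P (D.tauIVW σ) (D.tauGivenH P) v ∧
      FedRCT.HasAsympVar P D.tauMetaSW (D.tauGivenH P) (D.metaVar P β σ) ∧
      v ≤ D.metaVar P β σ) ∧
    -- unbiasedness of Meta-SW given the memberships and treatments
    (∀ (n : ℕ) (S : Set Ω), MeasurableSet[D.assignmentSigma n] S →
      (∀ᵐ ω ∂P, ω ∈ S → D.LocalFullRank n ω) → IntegrableOn (D.tauMetaSW n) S P →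
      ∫ ω in S, D.tauMetaSW n ω ∂P = ∫ ω in S, D.tauGivenH P n ω ∂P) ∧
    (∀ n : ℕ, 0 < n → ∫ ω, D.tauGivenH P n ω ∂P = D.tau P) ∧
    -- unbiasedness of Meta-SW given the whole design
    (∀ (n : ℕ) (S : Set Ω), MeasurableSet[D.designSigma n] S →
      (∀ᵐ ω ∂P, ω ∈ S → D.LocalFullRank n ω) → IntegrableOn (D.tauMetaSW n) S P →
      ∫ ω in S, D.tauMetaSW n ω ∂P =
        ∫ ω in S, D.sampleEffect c β n ω ∂P) ∧
    (∀ n : ℕ, 0 < n →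
      ∫ ω, D.sampleEffect c β n ω ∂P = D.tau P) ∧
    -- asymptotic unbiasedness on the event of local full rank
    ((∀ᶠ n in atTop, IntegrableOn (D.tauMetaSW n) {ω | D.LocalFullRank n ω} P) →
      Tendsto (fun n : ℕ => ∫ ω, D.tauMetaSW n ω ∂P[|{ω | D.LocalFullRank n ω}]) atTop
        (𝓝 (D.tau P))) := by
  -- Any study-level centring with mean `τ` centres the influence function; `t = τ` and `t = τ_k`
  -- give the two comparisons.
  have hmean : ∀ t : Fin K → ℝ, ∫ ω, t (FedRCT.Obs.cell (D.obs 0 ω)).1 ∂P = D.tau P →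
      ∫ ω, (FedRCT.Obs.effect c β (D.obs 0 ω) - t (FedRCT.Obs.cell (D.obs 0 ω)).1) ∂P = 0 := by
    intro t ht
    rw [integral_sub hD.integrable_effect
      ((hD.memLp_cell fun q => t q.1).integrable (by norm_num)), hD.integral_effect, ht, sub_self]
  refine ⟨?_, ?_, fun n S hS hfull hint => hD.setIntegral_tauMetaSW_eq_tauGivenH hS hfull hint,
    fun n hn => hD.integral_tauGivenH hn,
    fun n S hS hfull hint => hD.setIntegral_tauMetaSW_eq_sampleEffect hS hfull hint,
    fun n hn => hD.integral_sampleEffect hn, hD.tendsto_integral_tauMetaSW_cond⟩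
  · refine hD.exists_hasAsympVar (t := fun _ => D.tau P) (hmean (fun _ => D.tau P) (by simp))
      (fun n => measurable_const) (fun ω => ?_) hη θ₀ ?_
    -- For `n = 0` the average is `0` instead of `τ`.
    · filter_upwards [eventually_gt_atTop 0] with n hn
      have hn0 : (n : ℝ) ≠ 0 := by positivity
      simp [hn0]
    · rw [hD.integral_effect_sub_tau_sq, FedRCT.Units.metaVar]
      ring
  · refine hD.exists_hasAsympVar (t := D.tauStudy P) (hmean _ hD.integral_tauStudy)
      (D.measurable_tauGivenH hD.measurable_obs P)
      (fun ω => Eventually.of_forall fun n => D.tauGivenH_eq P n ω) hη θ₀ ?_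
    rw [hD.integral_effect_sub_tauStudy_sq, FedRCT.Units.metaVar]
    ring
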